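/- Let $\mathcal X,\mathcal Z$ be complex Hilbert spaces, $E\in L(\mathcal X,\mathcal Z)$ a bounded operator with closed range, and $A\colon\mathcal D(A)\subseteq\mathcal X\to\mathcal Z$ a closed, densely defined linear operator. Let $\rho(E,A)$ be the set of $\lambda\in\mathbb C$ for which $\lambda E-A\colon \mathcal D(A)\to\mathcal Z$ has an inverse $(\lambda E-A)^{-1}\in L(\mathcal Z,\mathcal X)$. Assume that $(E,A)$ has a complex radiality index $p\in\mathbb N_0$, i.e. there are $\omega,C>0$ such that every $\lambda$ with $\operatorname{Re}\lambda>\omega$ lies in $\rho(E,A)$ and $$\Big\|\prod_{k=0}^{p}(\lambda_kE-A)^{-1}E\Big\|\le\frac{C}{\prod_{k=0}^{p}|\lambda_k-\omega|},\qquad \Big\|\prod_{k=0}^{p}E(\lambda_kE-A)^{-1}\Big\|\le\frac{C}{\prod_{k=0}^{p}|\lambda_k-\omega|}$$ for all $\lambda_0,\dots,\lambda_p$ with real part $>\omega$. For arbitrary $\lambda_0,\dots,\lambda_p\in\rho(E,A)$ put $$\mathcal X^1=\overline{\operatorname{ran}\prod_{k=0}^{p}(\lambda_kE-A)^{-1}E},\quad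 \mathcal X^2=\ker\prod_{k=0}^{p}(\lambda_kE-A)^{-1}E,\quad \mathcal Z^1=\overline{\operatorname{ran}\prod_{k=0}^{p}E(\lambda_kE-A)^{-1}},\quad \mathcal Z^2=\ker\prod_{k=0}^{p}E(\lambda_kE-A)^{-1}.$$ Then $\mathcal X=\mathcal X^1\oplus\mathcal X^2$ and $\mathcal Z=\mathcal Z^1\oplus\mathcal Z^2$ (direct sums of closed subspaces), $\mathcal D(A)=(\mathcal D(A)\cap\mathcal X^1)\oplus(\mathcal D(A)\cap\mathcal X^2)$, and $E$ and $A$ are block diagonal: the restrictions $E_i=E|_{\mathcal X^i}\colon\mathcal X^i\to\mathcal Z^i$ and $A_i=A|_{\mathcal D(A_i)}\colon\mathcal D(A_i)=\mathcal D(A)\cap\mathcal X^i\to\mathcal Z^i$ ($i=1,2$) are well defined, $E_1$ and $A_2$ are bijective with bounded inverses $E_1^{-1}\in L(\mathcal Z^1,\mathcal X^1)$ and $A_2^{-1}\in L(\mathcal Z^2,\mathcal X^2)$, and $E_2A_2^{-1}$ and $A_2^{-1}E_2$ are nilpotent. (This is the decomposition underlying the Weierstraß forms of $(E,A)$, with nilpotent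 parts $E_2A_2^{-1}$, $A_2^{-1}E_2$ and differential parts $A_1E_1^{-1}$, $E_1^{-1}A_1$.) Moreover, the operator $A_1E_1^{-1}$ on $\mathcal Z^1$ with domain $E_1\mathcal D(A_1)$ and the operator $E_1^{-1}A_1$ on $\mathcal X^1$ with domain $\mathcal D(A_1)$ both generate integrated semigroups. Here an operator $B$ on a Banach space $\mathcal Y$ generates an integrated semigroup if there are $m\in\mathbb N_0$, $M,\omega'>0$ and a strongly continuous family $(S(t))_{t\ge0}$ in $L(\mathcal Y)$ with $\|S(t)\|\le Me^{\omega' t}$ for $t\ge0$, $(\omega',\infty)\subseteq\rho(B)$ and $$(\lambda I-B)^{-1}y=\lambda^{m}\int_0^\infty e^{-\lambda t}S(t)y\,dt\qquad(\lambda>\omega',\ y\in\mathcal Y).$$ -/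

import Mathlib

namespace DAE

section Pencil

variable {X Z : Type*} [NormedAddCommGroup X] [NormedSpace ℂ X]
  [NormedAddCommGroup Z] [NormedSpace ℂ Z]

/-- `B` is a bounded, everywhere defined two-sided inverse of `lam • E - A : D(A) → Z`. -/
def IsPencilInverse (E : X →L[ℂ] Z) (A : X →ₗ.[ℂ] Z) (lam : ℂ) (B : Z →L[ℂ] X) : Prop :=
  (∀ z : Z, ∃ h : B z ∈ A.domain, lam • E (B z) - A ⟨B z, h⟩ = z) ∧
    ∀ x : A.domain, B (lam • E (x : X) - A x) = (x : X)

theorem IsPencilInverse.unique {E : X →L[ℂ] Z} {A : X →ₗ.[ℂ] Z} {lam : ℂ} {B B' : Z →L[ℂ] X}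
    (h : IsPencilInverse E A lam B) (h' : IsPencilInverse E A lam B') : B = B' := by
  ext z
  obtain ⟨hz, hz'⟩ := h.1 z
  have := h'.2 ⟨B z, hz⟩
  simp only [hz'] at this
  exact this.symm

/-- The resolvent set `ρ(E, A)` of the operator pencil `lam ↦ lam • E - A`. -/
def resolventSet (E : X →L[ℂ] Z) (A : X →ₗ.[ℂ] Z) : Set ℂ :=
  {lam | ∃ B : Z →L[ℂ] X, IsPencilInverse E A lam B}

open Classical in
/-- The resolvent `(lam • E - A)⁻¹`, for `lam ∈ ρ(E, A)` (and `0` otherwise). -/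
noncomputable def resolvent (E : X →L[ℂ] Z) (A : X →ₗ.[ℂ] Z) (lam : ℂ) : Z →L[ℂ] X :=
  if h : ∃ B : Z →L[ℂ] X, IsPencilInverse E A lam B then h.choose else 0

theorem isPencilInverse_resolvent {E : X →L[ℂ] Z} {A : X →ₗ.[ℂ] Z} {lam : ℂ}
    (h : lam ∈ resolventSet E A) : IsPencilInverse E A lam (resolvent E A lam) := by
  have h' : ∃ B : Z →L[ℂ] X, IsPencilInverse E A lam B := h
  rw [resolvent, dif_pos h']
  exact h'.choose_spec

/-- `(lam 0 • E - A)⁻¹ E ⋯ (lam p • E - A)⁻¹ E`, a bounded operator on `X`. -/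
noncomputable def leftProd (E : X →L[ℂ] Z) (A : X →ₗ.[ℂ] Z) {p : ℕ} (lam : Fin (p + 1) → ℂ) :
    X →L[ℂ] X :=
  (List.ofFn fun k => resolvent E A (lam k) ∘L E).prod

/-- `E (lam 0 • E - A)⁻¹ ⋯ E (lam p • E - A)⁻¹`, a bounded operator on `Z`. -/
noncomputable def rightProd (E : X →L[ℂ] Z) (A : X →ₗ.[ℂ] Z) {p : ℕ} (lam : Fin (p + 1) → ℂ) :
    Z →L[ℂ] Z :=
  (List.ofFn fun k => E ∘L resolvent E A (lam k)).prod

/-- `(E, A)` has the complex radiality index `p`. -/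
def HasComplexRadialityIndex (E : X →L[ℂ] Z) (A : X →ₗ.[ℂ] Z) (p : ℕ) : Prop :=
  ∃ ω C : ℝ, 0 < ω ∧ 0 < C ∧ (∀ lam : ℂ, ω < lam.re → lam ∈ resolventSet E A) ∧
    ∀ lam : Fin (p + 1) → ℂ, (∀ k, ω < (lam k).re) →
      ‖leftProd E A lam‖ ≤ C / ∏ k, ‖lam k - (ω : ℂ)‖ ∧
      ‖rightProd E A lam‖ ≤ C / ∏ k, ‖lam k - (ω : ℂ)‖

/-- The closure of the range of `leftProd E A lam`. -/
noncomputable abbrev X₁ (E : X →L[ℂ] Z) (A : X →ₗ.[ℂ] Z) {p : ℕ} (lam : Fin (p + 1) → ℂ) :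
    Submodule ℂ X :=
  (LinearMap.range (leftProd E A lam : X →ₗ[ℂ] X)).topologicalClosure

/-- The kernel of `leftProd E A lam`. -/
noncomputable abbrev X₂ (E : X →L[ℂ] Z) (A : X →ₗ.[ℂ] Z) {p : ℕ} (lam : Fin (p + 1) → ℂ) :
    Submodule ℂ X :=
  LinearMap.ker (leftProd E A lam : X →ₗ[ℂ] X)

/-- The closure of the range of `rightProd E A lam`. -/
noncomputable abbrev Z₁ (E : X →L[ℂ] Z) (A : X →ₗ.[ℂ] Z) {p : ℕ} (lam : Fin (p + 1) → ℂ) :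
    Submodule ℂ Z :=
  (LinearMap.range (rightProd E A lam : Z →ₗ[ℂ] Z)).topologicalClosure

/-- The kernel of `rightProd E A lam`. -/
noncomputable abbrev Z₂ (E : X →L[ℂ] Z) (A : X →ₗ.[ℂ] Z) {p : ℕ} (lam : Fin (p + 1) → ℂ) :
    Submodule ℂ Z :=
  LinearMap.ker (rightProd E A lam : Z →ₗ[ℂ] Z)

end Pencil

section Splitting

variable {X Z : Type*} [NormedAddCommGroup X] [NormedSpace ℂ X]
  [NormedAddCommGroup Z] [NormedSpace ℂ Z]

/-- `B : U → V` is the restriction of `A` to `D(B) = D(A) ∩ U`, with values in `V`. -/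
def IsPart (A : X →ₗ.[ℂ] Z) {U : Submodule ℂ X} {V : Submodule ℂ Z} (B : U →ₗ.[ℂ] V) : Prop :=
  (∀ u : U, u ∈ B.domain ↔ (u : X) ∈ A.domain) ∧
    ∀ (u : B.domain) (x : A.domain), ((u : U) : X) = (x : X) → ((B u : V) : Z) = A x

/-- The block diagonalisation of `(E, A)` with respect to `X = U₁ ⊕ U₂` and `Z = V₁ ⊕ V₂`, with
`E₁ = E|U₁ : U₁ → V₁` and `A₂ = A|D(A) ∩ U₂ : D(A) ∩ U₂ → V₂` boundedly invertible and `E₂ A₂⁻¹`,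
`A₂⁻¹ E₂` nilpotent. All data are determined by `E`, `A` and the four subspaces. -/
structure WeierstrassSplitting (E : X →L[ℂ] Z) (A : X →ₗ.[ℂ] Z)
    (U₁ U₂ : Submodule ℂ X) (V₁ V₂ : Submodule ℂ Z) where
  isCompl_dom : IsCompl U₁ U₂
  isCompl_cod : IsCompl V₁ V₂
  /-- `D(A) = (D(A) ∩ U₁) ⊕ (D(A) ∩ U₂)` -/
  domain_splits : ∀ (u₁ : U₁) (u₂ : U₂), (u₁ : X) + (u₂ : X) ∈ A.domain →
    (u₁ : X) ∈ A.domain ∧ (u₂ : X) ∈ A.domain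
  /-- `E|U₁` -/
  E₁ : U₁ ≃L[ℂ] V₁
  E₁_apply : ∀ x : U₁, ((E₁ x : V₁) : Z) = E (x : X)
  /-- `E|U₂` -/
  E₂ : U₂ →L[ℂ] V₂
  E₂_apply : ∀ x : U₂, ((E₂ x : V₂) : Z) = E (x : X)
  /-- `A|D(A) ∩ U₁` -/
  A₁ : U₁ →ₗ.[ℂ] V₁
  A₁_isPart : IsPart A A₁
  /-- `A|D(A) ∩ U₂` -/
  A₂ : U₂ →ₗ.[ℂ] V₂
  A₂_isPart : IsPart A A₂
  /-- `A₂⁻¹` -/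
  A₂inv : V₂ →L[ℂ] U₂
  A₂_A₂inv : ∀ z : V₂, ∃ h : A₂inv z ∈ A₂.domain, A₂ ⟨A₂inv z, h⟩ = z
  A₂inv_A₂ : ∀ x : A₂.domain, A₂inv (A₂ x) = (x : U₂)
  isNilpotent_cod : IsNilpotent (E₂ ∘L A₂inv)
  isNilpotent_dom : IsNilpotent (A₂inv ∘L E₂)

namespace WeierstrassSplitting

variable {E : X →L[ℂ] Z} {A : X →ₗ.[ℂ] Z} {U₁ U₂ : Submodule ℂ X} {V₁ V₂ : Submodule ℂ Z}

/-- `A₁ E₁⁻¹` in `V₁`, with domain `{z | E₁⁻¹ z ∈ D(A₁)} = E₁ D(A₁)`. -/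
def A₁E₁inv (W : WeierstrassSplitting E A U₁ U₂ V₁ V₂) : V₁ →ₗ.[ℂ] V₁ where
  domain := W.A₁.domain.comap (W.E₁.symm : V₁ →ₗ[ℂ] U₁)
  toFun := W.A₁.toFun ∘ₗ
    ((W.E₁.symm : V₁ →ₗ[ℂ] U₁).restrict
      (p := W.A₁.domain.comap (W.E₁.symm : V₁ →ₗ[ℂ] U₁)) (q := W.A₁.domain) fun _ h => h)

/-- `E₁⁻¹ A₁` in `U₁`, with domain `D(A₁)`. -/
def E₁invA₁ (W : WeierstrassSplitting E A U₁ U₂ V₁ V₂) : U₁ →ₗ.[ℂ] U₁ where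
  domain := W.A₁.domain
  toFun := (W.E₁.symm : V₁ →ₗ[ℂ] U₁) ∘ₗ W.A₁.toFun

end WeierstrassSplitting

end Splitting

section IntegratedSemigroup

variable {Y : Type*} [NormedAddCommGroup Y] [NormedSpace ℂ Y] [CompleteSpace Y]

/-- `B` is the generator of the `m`-times integrated semigroup `(S t)_{t ≥ 0}`. -/
def IsGeneratorOfIntegratedSemigroup (B : Y →ₗ.[ℂ] Y) (m : ℕ) (S : ℝ → Y →L[ℂ] Y) : Prop :=
  (∀ y : Y, ContinuousOn (fun t => S t y) (Set.Ici 0)) ∧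
    ∃ M ω : ℝ, 0 < M ∧ 0 < ω ∧ (∀ t : ℝ, 0 ≤ t → ‖S t‖ ≤ M * Real.exp (ω * t)) ∧
      ∀ lam : ℝ, ω < lam →
        (lam : ℂ) ∈ resolventSet (ContinuousLinearMap.id ℂ Y) B ∧
        ∀ y : Y, resolvent (ContinuousLinearMap.id ℂ Y) B (lam : ℂ) y =
          (lam : ℂ) ^ m • ∫ t in Set.Ioi (0 : ℝ), ((Real.exp (-lam * t) : ℝ) : ℂ) • S t y

/-- `B` generates an integrated semigroup (`m`-times integrated, for some `m ≥ 0`). -/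
def GeneratesIntegratedSemigroup (B : Y →ₗ.[ℂ] Y) : Prop :=
  ∃ (m : ℕ) (S : ℝ → Y →L[ℂ] Y), IsGeneratorOfIntegratedSemigroup B m S

end IntegratedSemigroup

end DAE

/-!
For `l` in the resolvent set of the pencil, `(l E - A)⁻¹ E` and `E (l E - A)⁻¹` are
pseudo-resolvents: they satisfy `J l - J m = (m - l) J m J l`. Hence products of `p + 1` of their
values have the same kernel and range as `T = J(m) ^ (p + 1)` for any fixed `m`
(`IsPseudoResolvent.ker_range_prod`), and `m = ω + 1` may be chosen.

*Decomposition.* By the radial estimate the operators `((l - m) J(l)) ^ (p + 1)`, for real `l → ∞`,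
are bounded; they are multiples of `T`, and since `(l - m) J(l) J(m) = J(m) - J(l)` they tend to the
identity on the range of `T` (`IsPseudoResolvent.exists_approximate_identity`). As in the mean
ergodic theorem this makes `closure (range T) + ker T` direct and closed; applied to adjoints, the
directness shows that it is dense (`isCompl_closure_range_ker`).

*Block structure.* `E` and the resolvent `B = (m E - A)⁻¹` intertwine the two pseudo-resolvents, so
both are block diagonal, and so is `A`, whose domain is the range of `B`. The operator `E₁` is
injective because `ker E` lies in `ker T`, and surjective because the range of `E` is closed. On the
second blocks `E B` is nilpotent, and `A₂⁻¹ = -B (1 - m E B)⁻¹` is given by a finite Neumann series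
(`nonempty_weierstrassSplitting`).

*Generation.* The resolvents of `A₁ E₁⁻¹` and `E₁⁻¹ A₁` are restrictions of the two
pseudo-resolvents, and the radial estimate with the resolvent identity bounds these by a multiple
of `|z| ^ p` on a half-plane (`IsPseudoResolvent.exists_norm_le_mul_pow`). The inverse Laplace
transform of `z⁻⁽ᵖ⁺²⁾ J(z)` then converges absolutely and defines a `(p + 2)`-times integrated
semigroup; its Laplace transform is computed from Fubini's theorem, the resolvent identity and
Cauchy's theorem (`generatesIntegratedSemigroup_of_norm_le`).
-/

namespace DAE

/-! ### Integrals along vertical lines -/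

section ContourIntegrals

open MeasureTheory Filter Topology Complex

theorem one_le_norm_of_one_le_re {a : ℝ} (ha : 1 ≤ a) {z : ℂ} (hz : a ≤ z.re) : 1 ≤ ‖z‖ :=
  ha.trans (hz.trans ((le_abs_self _).trans (Complex.abs_re_le_norm z)))

theorem one_add_sq_le_norm_sq {a : ℝ} (ha : 1 ≤ a) (s : ℝ) : 1 + s ^ 2 ≤ ‖(a : ℂ) + s * I‖ ^ 2 := by
  rw [← Complex.normSq_eq_norm_sq, Complex.normSq_add_mul_I]
  nlinarith

theorem norm_le_mul_inv_one_add_sq {V : Type*} [NormedAddCommGroup V] {g : ℂ → V} {a K : ℝ}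
    (ha : 1 ≤ a) (hK : ∀ z : ℂ, a ≤ z.re → ‖g z‖ ≤ K / ‖z‖ ^ 2) (s : ℝ) :
    ‖g (a + s * I)‖ ≤ K * (1 + s ^ 2)⁻¹ := by
  have h := hK (a + s * I) (by simp)
  have h1 := one_add_sq_le_norm_sq ha s
  have h0 : 0 < 1 + s ^ 2 := by positivity
  have hK0 : 0 ≤ K := by
    have h2 := (norm_nonneg _).trans h
    have h3 : 0 < ‖(a : ℂ) + s * I‖ ^ 2 := by linarith
    by_contra! hneg
    exact absurd h2 (not_le.2 (div_neg_of_neg_of_pos hneg h3))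
  refine h.trans ?_
  rw [div_eq_mul_inv]
  gcongr

theorem continuous_vertical {V : Type*} [TopologicalSpace V] {g : ℂ → V} {a : ℝ}
    (hg : ContinuousOn g {z | a ≤ z.re}) :
    Continuous fun s : ℝ => g (a + s * I) :=
  hg.comp_continuous (by fun_prop) (by simp)

theorem integrable_vertical {V : Type*} [NormedAddCommGroup V] {g : ℂ → V} {a K : ℝ} (ha : 1 ≤ a)
    (hg : ContinuousOn g {z | a ≤ z.re}) (hK : ∀ z : ℂ, a ≤ z.re → ‖g z‖ ≤ K / ‖z‖ ^ 2) :
    Integrable fun s : ℝ => g (a + s * I) :=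
  (integrable_inv_one_add_sq.const_mul K).mono'
    (continuous_vertical hg).aestronglyMeasurable
    (.of_forall (norm_le_mul_inv_one_add_sq ha hK))

/-- Cauchy's theorem on the rectangles with vertices `a ± iT`, `a + T ± iT`: a function that is
holomorphic on a right half-plane and `O(|z|⁻²)` there integrates to zero along its boundary, as
the other three sides have total length `4T`. -/
theorem integral_vertical_eq_zero {V : Type*} [NormedAddCommGroup V] [NormedSpace ℂ V]
    [CompleteSpace V] {g : ℂ → V} {a K : ℝ} (ha : 1 ≤ a)
    (hg : DifferentiableOn ℂ g {z | a ≤ z.re}) (hK : ∀ z : ℂ, a ≤ z.re → ‖g z‖ ≤ K / ‖z‖ ^ 2) :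
    ∫ s : ℝ, g (a + s * I) = 0 := by
  have hint := integrable_vertical ha hg.continuousOn hK
  have hlim := intervalIntegral_tendsto_integral hint tendsto_neg_atTop_atBot tendsto_id
  have hK0 : 0 ≤ K := by
    have h := (norm_nonneg _).trans (hK a (by simp))
    have h3 : 0 < ‖(a : ℂ)‖ ^ 2 := by
      have := one_le_norm_of_one_le_re ha (z := a) (by simp)
      positivity
    by_contra! hneg
    exact absurd h (not_le.2 (div_neg_of_neg_of_pos hneg h3))
  refine tendsto_nhds_unique hlim ?_
  have hbound : ∀ᶠ T : ℝ in atTop, ‖∫ s in (-T)..(id T), g (a + s * I)‖ ≤ 4 * K * T⁻¹ := by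
    filter_upwards [eventually_gt_atTop 0] with T hT
    have hrect := Complex.integral_boundary_rect_eq_zero_of_differentiableOn g
      (a + (-T : ℝ) * I) ((a + T : ℝ) + (T : ℝ) * I) (hg.mono ?_)
    · simp only [add_re, ofReal_re, mul_re, I_re, mul_zero, ofReal_im, I_im, mul_one, sub_self,
        add_zero, add_im, mul_im, zero_add] at hrect
      have hsmall : ∀ z : ℂ, a ≤ z.re → T ≤ ‖z‖ → ‖g z‖ ≤ K / T ^ 2 := fun z hz hT' =>
        (hK z hz).trans (by gcongr)
      have h1 : ‖∫ x in a..(a + T), g (x + (-T : ℝ) * I)‖ ≤ K / T ^ 2 * |a + T - a| := by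
        refine intervalIntegral.norm_integral_le_of_norm_le_const fun x hx => ?_
        rw [Set.uIoc_of_le (by linarith)] at hx
        refine hsmall _ (by simpa using hx.1.le) ?_
        refine le_trans ?_ (Complex.abs_im_le_norm _)
        simp [le_abs_self]
      have h2 : ‖∫ x in a..(a + T), g (x + T * I)‖ ≤ K / T ^ 2 * |a + T - a| := by
        refine intervalIntegral.norm_integral_le_of_norm_le_const fun x hx => ?_
        rw [Set.uIoc_of_le (by linarith)] at hx
        refine hsmall _ (by simpa using hx.1.le) ?_
        refine le_trans ?_ (Complex.abs_im_le_norm _)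
        simp [le_abs_self]
      have h3 : ‖∫ y in (-T)..T, g ((a + T : ℝ) + y * I)‖ ≤ K / T ^ 2 * |T - -T| := by
        refine intervalIntegral.norm_integral_le_of_norm_le_const fun y _ => ?_
        refine hsmall _ (by simpa using hT.le) ?_
        refine le_trans ?_ (Complex.abs_re_le_norm _)
        simp only [add_re, ofReal_re, mul_re, I_re, mul_zero, ofReal_im, I_im, mul_one, sub_self,
          add_zero]
        exact le_trans (by linarith) (le_abs_self _)
      have hE : ‖∫ y in (-T)..T, g (a + y * I)‖ =
          ‖I • ∫ y in (-T)..T, g (a + y * I)‖ := by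
        rw [norm_smul, Complex.norm_I, one_mul]
      rw [id, hE, ← sub_eq_zero.1 hrect]
      refine (norm_add_le _ _).trans ?_
      rw [norm_smul, Complex.norm_I, one_mul]
      refine (add_le_add ((norm_sub_le _ _).trans (add_le_add h1 h2)) h3).trans (le_of_eq ?_)
      rw [show a + T - a = T by ring, show T - -T = 2 * T by ring, abs_of_pos hT,
        abs_of_pos (by positivity)]
      field_simp
      ring
    · intro z hz
      have := hz.1
      simp only [add_re, ofReal_re, mul_re, I_re, mul_zero, ofReal_im, I_im, mul_one, sub_self,
        add_zero, Set.mem_preimage] at this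
      rw [Set.uIcc_of_le (by linarith)] at this
      exact this.1
  refine squeeze_zero_norm' hbound ?_
  simpa using tendsto_inv_atTop_zero.const_mul (4 * K)

theorem integrable_poisson {a : ℝ} (ha : 0 < a) : Integrable fun s : ℝ => a / (a ^ 2 + s ^ 2) := by
  have h := (integrable_inv_one_add_sq.comp_div ha.ne').const_mul a⁻¹
  refine h.congr (.of_forall fun s => ?_)
  simp only
  field_simp

theorem integral_poisson {a : ℝ} (ha : 0 < a) :
    ∫ s : ℝ, a / (a ^ 2 + s ^ 2) = Real.pi := by
  have h := Measure.integral_comp_div (fun x : ℝ => (1 + x ^ 2)⁻¹) a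
  rw [integral_univ_inv_one_add_sq, abs_of_pos ha, smul_eq_mul] at h
  have h2 : ∀ s : ℝ, a / (a ^ 2 + s ^ 2) = a⁻¹ * (1 + (s / a) ^ 2)⁻¹ := fun s => by field_simp
  simp_rw [h2]
  rw [integral_const_mul, h]
  field_simp

theorem add_mul_I_ne_zero {a : ℝ} (ha : 0 < a) (s : ℝ) : (a : ℂ) + s * I ≠ 0 := fun h => by
  have := congrArg re h
  simp at this
  exact ha.ne' this

theorem sub_vertical_ne_zero {a l : ℝ} (hl : a < l) (s : ℝ) : (l : ℂ) - (a + s * I) ≠ 0 :=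
  fun h => by
    have := congrArg re h
    simp at this
    linarith

theorem integrable_inv_mul_inv_sub {a l : ℝ} (ha : 0 < a) (hl : a < l) :
    Integrable fun s : ℝ => ((a : ℂ) + s * I)⁻¹ * ((l : ℂ) - (a + s * I))⁻¹ := by
  have hb : 0 < l - a := by linarith
  refine (((integrable_poisson ha).const_mul a⁻¹).add
    ((integrable_poisson hb).const_mul (l - a)⁻¹)).mono' ?_ (.of_forall fun s => ?_)
  · refine Continuous.aestronglyMeasurable (Continuous.mul ?_ ?_)
    · exact Continuous.inv₀ (by fun_prop) (add_mul_I_ne_zero ha)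
    · exact Continuous.inv₀ (by fun_prop) (sub_vertical_ne_zero hl)
  · have h1 : ‖(a : ℂ) + s * I‖⁻¹ ^ 2 = a⁻¹ * (a / (a ^ 2 + s ^ 2)) := by
      rw [inv_pow, ← Complex.normSq_eq_norm_sq, Complex.normSq_add_mul_I]
      field_simp
    have h2 : ‖(l : ℂ) - (a + s * I)‖⁻¹ ^ 2
        = (l - a)⁻¹ * ((l - a) / ((l - a) ^ 2 + s ^ 2)) := by
      have : (l : ℂ) - (a + s * I) = (l - a : ℝ) + (-s : ℝ) * I := by push_cast; ring
      rw [inv_pow, ← Complex.normSq_eq_norm_sq, this, Complex.normSq_add_mul_I]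
      field_simp
    simp only [Pi.add_apply]
    rw [norm_mul, norm_inv, norm_inv, ← h1, ← h2]
    nlinarith [sq_nonneg (‖(a : ℂ) + s * I‖⁻¹ - ‖(l : ℂ) - (a + s * I)‖⁻¹),
      sq_nonneg (‖(a : ℂ) + s * I‖⁻¹), sq_nonneg (‖(l : ℂ) - (a + s * I)‖⁻¹)]

/-- Adding the values at `s` and `-s` turns the integrand into a sum of two Poisson kernels. -/
theorem integral_inv_mul_inv_sub {a l : ℝ} (ha : 0 < a) (hl : a < l) :
    ∫ s : ℝ, ((a : ℂ) + s * I)⁻¹ * ((l : ℂ) - (a + s * I))⁻¹ = 2 * Real.pi * (l : ℂ)⁻¹ := by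
  have hb : 0 < l - a := by linarith
  have hl0 : 0 < l := by linarith
  set f : ℝ → ℂ := fun s => ((a : ℂ) + s * I)⁻¹ * ((l : ℂ) - (a + s * I))⁻¹ with hf
  have hint : Integrable f := integrable_inv_mul_inv_sub ha hl
  have hneg : ∫ s, f (-s) = ∫ s, f s := integral_neg_eq_self f volume
  have hsum : ∀ s, f s + f (-s) =
      ((l⁻¹ * (2 * (a / (a ^ 2 + s ^ 2)) + 2 * ((l - a) / ((l - a) ^ 2 + s ^ 2))) : ℝ) : ℂ) := by
    intro s
    have e1 := add_mul_I_ne_zero ha s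
    have e2 := add_mul_I_ne_zero ha (-s)
    have e3 := sub_vertical_ne_zero hl s
    have e4 := sub_vertical_ne_zero hl (-s)
    have e5 : (l : ℂ) ≠ 0 := by exact_mod_cast hl0.ne'
    have e6 : ((a : ℂ) ^ 2 + s ^ 2) = (a + s * I) * (a + (-s : ℝ) * I) := by
      push_cast; ring_nf; rw [I_sq]; ring
    have e7 : (((l : ℂ) - a) ^ 2 + s ^ 2) =
        ((l : ℂ) - (a + s * I)) * ((l : ℂ) - (a + (-s : ℝ) * I)) := by
      push_cast; ring_nf; rw [I_sq]; ring
    simp only [hf]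
    push_cast at e2 e4 e6 e7 ⊢
    have p1 : ((a : ℂ) + s * I)⁻¹ + (a + -s * I)⁻¹ = 2 * (a / (a ^ 2 + s ^ 2)) := by
      rw [e6, inv_add_inv e1 e2, ← mul_div_assoc]
      congr 1
      ring
    have p2 : ((l : ℂ) - (a + s * I))⁻¹ + (l - (a + -s * I))⁻¹ =
        2 * ((l - a) / ((l - a) ^ 2 + s ^ 2)) := by
      rw [e7, inv_add_inv e3 e4, ← mul_div_assoc]
      congr 1
      ring
    have hpf : ∀ u : ℂ, u ≠ 0 → (l : ℂ) - u ≠ 0 →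
        u⁻¹ * (l - u)⁻¹ = (l : ℂ)⁻¹ * (u⁻¹ + (l - u)⁻¹) := fun u hu hv => by
      field_simp
      ring
    rw [← p1, ← p2, hpf _ e1 e3, hpf _ e2 e4]
    ring
  have h2 : (∫ s, f s) + ∫ s, f (-s) = 4 * Real.pi * (l : ℂ)⁻¹ := by
    rw [← integral_add hint hint.comp_neg]
    simp_rw [hsum]
    rw [integral_complex_ofReal, integral_const_mul, integral_add
      ((integrable_poisson ha).const_mul 2) ((integrable_poisson hb).const_mul 2),
      integral_const_mul, integral_const_mul, integral_poisson ha, integral_poisson hb]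
    push_cast
    ring
  rw [hneg] at h2
  linear_combination h2 / 2

theorem integral_inv_pow_vertical {a : ℝ} (ha : 1 ≤ a) (m : ℕ) :
    Integrable (fun s : ℝ => (((a : ℂ) + s * I) ^ (m + 2))⁻¹) ∧
      ∫ s : ℝ, (((a : ℂ) + s * I) ^ (m + 2))⁻¹ = 0 := by
  have hd : DifferentiableOn ℂ (fun z : ℂ => (z ^ (m + 2))⁻¹) {z | a ≤ z.re} := by
    refine DifferentiableOn.inv (by fun_prop) fun z hz => pow_ne_zero _ fun h => ?_
    have := one_le_norm_of_one_le_re ha hz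
    rw [h, norm_zero] at this
    linarith
  have hb : ∀ z : ℂ, a ≤ z.re → ‖(z ^ (m + 2))⁻¹‖ ≤ 1 / ‖z‖ ^ 2 := fun z hz => by
    have := one_le_norm_of_one_le_re ha hz
    rw [norm_inv, norm_pow, one_div]
    gcongr
    lia
  exact ⟨integrable_vertical ha hd.continuousOn hb, integral_vertical_eq_zero ha hd hb⟩

/-- The Laplace transform of `t ↦ t ^ m / m !`, in the form in which Laplace inversion meets it.
The partial fraction `1 / (z (l - z)) = l⁻¹ (1 / z + 1 / (l - z))` lowers the exponent. -/
theorem integral_inv_pow_mul_inv_sub {a l : ℝ} (ha : 1 ≤ a) (hl : a < l) (m : ℕ) :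
    Integrable (fun s : ℝ => (((a : ℂ) + s * I) ^ (m + 1))⁻¹ * ((l : ℂ) - (a + s * I))⁻¹) ∧
      ∫ s : ℝ, (((a : ℂ) + s * I) ^ (m + 1))⁻¹ * ((l : ℂ) - (a + s * I))⁻¹ =
        2 * Real.pi * ((l : ℂ) ^ (m + 1))⁻¹ := by
  have ha0 : 0 < a := by linarith
  have e5 : (l : ℂ) ≠ 0 := by exact_mod_cast (ha0.trans hl).ne'
  induction m with
  | zero =>
    simp only [zero_add, pow_one]
    exact ⟨integrable_inv_mul_inv_sub ha0 hl, integral_inv_mul_inv_sub ha0 hl⟩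
  | succ m ih =>
    have hpf : ∀ s : ℝ, (((a : ℂ) + s * I) ^ (m + 1 + 1))⁻¹ * ((l : ℂ) - (a + s * I))⁻¹ =
        (l : ℂ)⁻¹ * ((((a : ℂ) + s * I) ^ (m + 2))⁻¹ +
          (((a : ℂ) + s * I) ^ (m + 1))⁻¹ * ((l : ℂ) - (a + s * I))⁻¹) := fun s => by
      have e1 := add_mul_I_ne_zero ha0 s
      have e3 := sub_vertical_ne_zero hl s
      field_simp
      ring
    obtain ⟨hi, h0⟩ := integral_inv_pow_vertical ha m
    simp_rw [hpf]
    refine ⟨(hi.add ih.1).const_mul _, ?_⟩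
    rw [integral_const_mul, integral_add hi ih.1, h0, ih.2]
    field_simp
    ring

end ContourIntegrals

/-! ### The resolvent identity -/

section Resolvents

variable {X Z : Type*} [NormedAddCommGroup X] [NormedSpace ℂ X]
  [NormedAddCommGroup Z] [NormedSpace ℂ Z] {E : X →L[ℂ] Z} {A : X →ₗ.[ℂ] Z}

/-- The resolvent identity of the pencil. -/
theorem IsPencilInverse.sub_apply {l m : ℂ} {B B' : Z →L[ℂ] X}
    (h : IsPencilInverse E A l B) (h' : IsPencilInverse E A m B') (z : Z) :
    B z - B' z = (m - l) • B' (E (B z)) := by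
  obtain ⟨hz, hz'⟩ := h.1 z
  have key := h'.2 ⟨B z, hz⟩
  have hA : A ⟨B z, hz⟩ = l • E (B z) - z := 
    eq_sub_of_add_eq' (sub_eq_iff_eq_add.1 hz').symm
  simp only [hA] at key
  have : m • E (B z) - (l • E (B z) - z) = (m - l) • E (B z) + z := by rw [sub_smul]; abel
  rw [this, map_add, map_smul] at key
  exact sub_eq_of_eq_add key.symm

theorem IsPencilInverse.resolvent_eq {l : ℂ} {B : Z →L[ℂ] X} (h : IsPencilInverse E A l B) :
    resolvent E A l = B :=
  (isPencilInverse_resolvent ⟨B, h⟩).unique h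

end Resolvents

/-! ### Laplace inversion and generation -/

section Generation

open MeasureTheory Filter Topology Complex

variable {Y : Type*} [NormedAddCommGroup Y] [NormedSpace ℂ Y]
  {G : Y →ₗ.[ℂ] Y} {J : ℂ → Y →L[ℂ] Y} {a K : ℝ} {p : ℕ}

theorem hasDerivWithinAt_resolvent
    (hJ : ∀ z : ℂ, a ≤ z.re → IsPencilInverse (ContinuousLinearMap.id ℂ Y) G z (J z))
    (hK : ∀ z : ℂ, a ≤ z.re → ‖J z‖ ≤ K * ‖z‖ ^ p) {w : ℂ} (hw : a ≤ w.re) :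
    HasDerivWithinAt J (-(J w * J w)) {z | a ≤ z.re} w := by
  have hid : ∀ z : ℂ, a ≤ z.re → J z - J w = (w - z) • (J w * J z) := fun z hz => by
    ext y
    simpa using (hJ z hz).sub_apply (hJ w hw) y
  have hcont : ContinuousWithinAt J {z | a ≤ z.re} w := by
    have h0 : Tendsto (fun z => ‖w - z‖ * (‖J w‖ * (K * ‖z‖ ^ p))) (𝓝[{z | a ≤ z.re}] w)
        (𝓝 0) := by
      have : Continuous fun z => ‖w - z‖ * (‖J w‖ * (K * ‖z‖ ^ p)) := by fun_prop
      simpa using (this.tendsto w).mono_left nhdsWithin_le_nhds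
    rw [ContinuousWithinAt, tendsto_iff_norm_sub_tendsto_zero]
    refine squeeze_zero' (.of_forall fun _ => norm_nonneg _) ?_ h0
    filter_upwards [self_mem_nhdsWithin] with z hz
    rw [hid z hz, norm_smul]
    gcongr
    refine (norm_mul_le _ _).trans ?_
    gcongr
    exact hK z hz
  rw [hasDerivWithinAt_iff_tendsto_slope]
  have hlim : Tendsto (fun z => -(J w * J z)) (𝓝[{z | a ≤ z.re} \ {w}] w) (𝓝 (-(J w * J w))) :=
    ((tendsto_const_nhds.mul hcont.tendsto).neg).mono_left (nhdsWithin_mono _ Set.sdiff_subset)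
  refine hlim.congr' ?_
  filter_upwards [self_mem_nhdsWithin] with z hz
  have hne : z - w ≠ 0 := sub_ne_zero.2 hz.2
  rw [slope_def_module, hid z hz.1, ← neg_sub z w, neg_smul, smul_neg, smul_smul,
    inv_mul_cancel₀ hne, one_smul]

/-- The integrand of the Laplace inversion formula, without its exponential factor. -/
noncomputable def laplaceDensity (J : ℂ → Y →L[ℂ] Y) (m : ℕ) (z : ℂ) : Y →L[ℂ] Y :=
  (z ^ m)⁻¹ • J z

/-- The Laplace inversion integral `(2πi)⁻¹ ∫ exp (z t) z⁻ᵐ J(z) dz` along the line `Re z = a`,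
parametrised by `z = a + i s`. -/
noncomputable def laplaceInversion (J : ℂ → Y →L[ℂ] Y) (m : ℕ) (a t : ℝ) : Y →L[ℂ] Y :=
  ((2 * Real.pi : ℝ) : ℂ)⁻¹ • ∫ s : ℝ, exp ((a + s * I) * t) • laplaceDensity J m (a + s * I)

theorem norm_laplaceDensity_le (ha : 1 ≤ a)
    (hK : ∀ z : ℂ, a ≤ z.re → ‖J z‖ ≤ K * ‖z‖ ^ p) {z : ℂ} (hz : a ≤ z.re) :
    ‖laplaceDensity J (p + 2) z‖ ≤ K / ‖z‖ ^ 2 := by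
  have h0 : 0 < ‖z‖ := zero_lt_one.trans_le (one_le_norm_of_one_le_re ha hz)
  rw [laplaceDensity, norm_smul, norm_inv, norm_pow, pow_add]
  calc (‖z‖ ^ p * ‖z‖ ^ 2)⁻¹ * ‖J z‖ ≤ (‖z‖ ^ p * ‖z‖ ^ 2)⁻¹ * (K * ‖z‖ ^ p) := by
        gcongr
        exact hK z hz
    _ = K / ‖z‖ ^ 2 := by field_simp

theorem differentiableOn_laplaceDensity (ha : 1 ≤ a)
    (hJ : ∀ z : ℂ, a ≤ z.re → IsPencilInverse (ContinuousLinearMap.id ℂ Y) G z (J z))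
    (hK : ∀ z : ℂ, a ≤ z.re → ‖J z‖ ≤ K * ‖z‖ ^ p) :
    DifferentiableOn ℂ (laplaceDensity J (p + 2)) {z | a ≤ z.re} := by
  have hinv : DifferentiableOn ℂ (fun z : ℂ => (z ^ (p + 2))⁻¹) {z | a ≤ z.re} :=
    DifferentiableOn.inv (by fun_prop) fun z hz => pow_ne_zero _
      (norm_pos_iff.1 (zero_lt_one.trans_le (one_le_norm_of_one_le_re ha hz)))
  exact hinv.smul fun w hw => (hasDerivWithinAt_resolvent hJ hK hw).differentiableWithinAt

theorem norm_exp_vertical (a s t : ℝ) : ‖exp ((a + s * I) * t)‖ = Real.exp (a * t) := by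
  rw [Complex.norm_exp]
  simp

theorem integrable_laplaceDensity (ha : 1 ≤ a)
    (hJ : ∀ z : ℂ, a ≤ z.re → IsPencilInverse (ContinuousLinearMap.id ℂ Y) G z (J z))
    (hK : ∀ z : ℂ, a ≤ z.re → ‖J z‖ ≤ K * ‖z‖ ^ p) :
    Integrable fun s : ℝ => laplaceDensity J (p + 2) (a + s * I) :=
  integrable_vertical ha (differentiableOn_laplaceDensity ha hJ hK).continuousOn
    fun _ => norm_laplaceDensity_le ha hK

theorem continuous_laplaceDensity (ha : 1 ≤ a)
    (hJ : ∀ z : ℂ, a ≤ z.re → IsPencilInverse (ContinuousLinearMap.id ℂ Y) G z (J z))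
    (hK : ∀ z : ℂ, a ≤ z.re → ‖J z‖ ≤ K * ‖z‖ ^ p) :
    Continuous fun s : ℝ => laplaceDensity J (p + 2) (a + s * I) :=
  continuous_vertical (differentiableOn_laplaceDensity ha hJ hK).continuousOn

theorem integrable_exp_smul_laplaceDensity (ha : 1 ≤ a)
    (hJ : ∀ z : ℂ, a ≤ z.re → IsPencilInverse (ContinuousLinearMap.id ℂ Y) G z (J z))
    (hK : ∀ z : ℂ, a ≤ z.re → ‖J z‖ ≤ K * ‖z‖ ^ p) (t : ℝ) :
    Integrable fun s : ℝ => exp ((a + s * I) * t) • laplaceDensity J (p + 2) (a + s * I) := by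
  have hc : Continuous fun s : ℝ => exp ((a + s * I) * t) := by fun_prop
  exact (integrable_laplaceDensity ha hJ hK).bdd_smul (Real.exp (a * t))
    hc.aestronglyMeasurable (.of_forall fun s => (norm_exp_vertical a s t).le)

theorem continuous_laplaceInversion (ha : 1 ≤ a)
    (hJ : ∀ z : ℂ, a ≤ z.re → IsPencilInverse (ContinuousLinearMap.id ℂ Y) G z (J z))
    (hK : ∀ z : ℂ, a ≤ z.re → ‖J z‖ ≤ K * ‖z‖ ^ p) :
    Continuous (laplaceInversion J (p + 2) a) := by
  have hF := integrable_laplaceDensity ha hJ hK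
  have hFc := continuous_laplaceDensity ha hJ hK
  have heq : laplaceInversion J (p + 2) a = fun t : ℝ => ((2 * Real.pi : ℝ) : ℂ)⁻¹ •
      exp (a * t) • ∫ s : ℝ, exp (s * I * t) • laplaceDensity J (p + 2) (a + s * I) := by
    funext t
    rw [laplaceInversion]
    congr 1
    rw [← integral_smul]
    simp_rw [smul_smul, ← Complex.exp_add, add_mul]
  rw [heq]
  have hexp : Continuous fun t : ℝ => exp (a * t) := by fun_prop
  suffices Continuous fun t : ℝ => ∫ s : ℝ, exp (s * I * t) • laplaceDensity J (p + 2) (a + s * I)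
    from (hexp.smul this).const_smul ((2 * Real.pi : ℝ) : ℂ)⁻¹
  refine continuous_of_dominated
    (F := fun t s : ℝ => exp (s * I * t) • laplaceDensity J (p + 2) (a + s * I))
    (fun t => Continuous.aestronglyMeasurable (by fun_prop))
    (fun t => .of_forall fun s => ?_) hF.norm (.of_forall fun s => by fun_prop)
  rw [norm_smul, Complex.norm_exp]
  simp

theorem norm_laplaceInversion_le (J : ℂ → Y →L[ℂ] Y) (m : ℕ) (a t : ℝ) :
    ‖laplaceInversion J m a t‖ ≤
      (2 * Real.pi)⁻¹ * (∫ s : ℝ, ‖laplaceDensity J m (a + s * I)‖) * Real.exp (a * t) := by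
  have hpi := Real.pi_pos
  rw [laplaceInversion, norm_smul, norm_inv, Complex.norm_real, Real.norm_of_nonneg (by positivity),
    mul_assoc, ← integral_mul_const]
  gcongr
  refine (norm_integral_le_integral_norm _).trans (le_of_eq ?_)
  simp_rw [norm_smul, norm_exp_vertical, mul_comm]

theorem integral_exp_sub_vertical {a l : ℝ} (hl : a < l) (s : ℝ) :
    ∫ t : ℝ in Set.Ioi 0, exp (((a + s * I) - l) * t) = ((l : ℂ) - (a + s * I))⁻¹ := by
  rw [integral_exp_mul_complex_Ioi (by simpa using hl)]
  simp only [ofReal_zero, mul_zero, Complex.exp_zero]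
  rw [← neg_sub (l : ℂ), neg_div_neg_eq, one_div]

/-- By Fubini the Laplace transform of the inversion integral is
`(2πi)⁻¹ ∫ z⁻ᵐ (l - z)⁻¹ J(z) dz`. The resolvent identity splits `(l - z)⁻¹ J(z)` into
`(l - z)⁻¹ J(l)`, which contributes `l⁻ᵐ J(l)`, and `J(l) J(z)`, which contributes zero by
Cauchy's theorem. -/
theorem integral_exp_smul_laplaceInversion [CompleteSpace Y] (ha : 1 ≤ a)
    (hJ : ∀ z : ℂ, a ≤ z.re → IsPencilInverse (ContinuousLinearMap.id ℂ Y) G z (J z))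
    (hK : ∀ z : ℂ, a ≤ z.re → ‖J z‖ ≤ K * ‖z‖ ^ p) {l : ℝ} (hl : a < l) (y : Y) :
    ∫ t in Set.Ioi (0 : ℝ), ((Real.exp (-l * t) : ℝ) : ℂ) • laplaceInversion J (p + 2) a t y =
      ((l : ℂ) ^ (p + 2))⁻¹ • J l y := by
  have hF := integrable_laplaceDensity ha hJ hK
  have hFc := continuous_laplaceDensity ha hJ hK
  have hFy : Integrable fun s : ℝ => laplaceDensity J (p + 2) (a + s * I) y :=
    hF.apply_continuousLinearMap y
  have hint0 : ∫ s : ℝ, laplaceDensity J (p + 2) (a + s * I) y = 0 := by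
    rw [← ContinuousLinearMap.integral_apply hF, integral_vertical_eq_zero ha
      (differentiableOn_laplaceDensity ha hJ hK) fun _ => norm_laplaceDensity_le ha hK]
    rfl
  have hstep : ∀ t : ℝ, ((Real.exp (-l * t) : ℝ) : ℂ) • laplaceInversion J (p + 2) a t y =
      ((2 * Real.pi : ℝ) : ℂ)⁻¹ • ∫ s : ℝ, exp (((a + s * I) - l) * t) •
        laplaceDensity J (p + 2) (a + s * I) y := fun t => by
    rw [laplaceInversion, smul_apply, ContinuousLinearMap.integral_apply
      (integrable_exp_smul_laplaceDensity ha hJ hK t), smul_comm, ← integral_smul]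
    congr 2
    funext s
    rw [smul_apply, smul_smul]
    congr 1
    push_cast
    rw [← Complex.exp_add]
    congr 1
    ring
  have hprod : Integrable (Function.uncurry fun (t s : ℝ) => exp (((a + s * I) - l) * t) •
      laplaceDensity J (p + 2) (a + s * I) y) ((volume.restrict (Set.Ioi 0)).prod volume) := by
    refine ((integrableOn_exp_mul_Ioi (a := a - l) (by linarith) 0).mul_prod hFy.norm).mono'
      (Continuous.aestronglyMeasurable ?_) (.of_forall fun q => ?_)
    · have : Continuous fun q : ℝ × ℝ => laplaceDensity J (p + 2) (a + q.2 * I) :=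
        hFc.comp continuous_snd
      simp only [Function.uncurry_def]
      fun_prop
    · simp only [Function.uncurry, norm_smul, Complex.norm_exp]
      simp
  have hres : ∀ s : ℝ, ((l : ℂ) - (a + s * I))⁻¹ • laplaceDensity J (p + 2) (a + s * I) y =
      ((((a : ℂ) + s * I) ^ (p + 1 + 1))⁻¹ * ((l : ℂ) - (a + s * I))⁻¹) • J l y +
        J l (laplaceDensity J (p + 2) (a + s * I) y) := fun s => by
    have hne := sub_vertical_ne_zero hl s
    have hid := (hJ (a + s * I) (by simp)).sub_apply (hJ l (by simpa using hl.le)) y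
    rw [sub_eq_iff_eq_add] at hid
    simp only [laplaceDensity, smul_apply, map_smul]
    nth_rewrite 1 [hid]
    rw [smul_add, smul_add, smul_smul, smul_smul, smul_smul, add_comm]
    congr 2
    · ring
    · rw [mul_comm ((l : ℂ) - _)⁻¹, mul_assoc, inv_mul_cancel₀ hne, mul_one]
  obtain ⟨hsi, hsv⟩ := integral_inv_pow_mul_inv_sub ha hl (p + 1)
  simp_rw [hstep]
  rw [integral_smul, integral_integral_swap hprod]
  simp_rw [integral_smul_const, integral_exp_sub_vertical hl, hres]
  rw [integral_add (hsi.smul_const _) ((J l).integrable_comp hFy), integral_smul_const, hsv,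
    ContinuousLinearMap.integral_comp_comm _ hFy, hint0, map_zero, add_zero, smul_smul]
  congr 1
  have : (Real.pi : ℂ) ≠ 0 := by exact_mod_cast Real.pi_ne_zero
  push_cast
  field_simp

/-- A resolvent that grows polynomially on a right half-plane belongs to the generator of an
integrated semigroup: `z⁻ᵐ J(z)` is `O(|z|⁻²)` for large `m`, so that its inverse Laplace transform
converges absolutely. -/
theorem generatesIntegratedSemigroup_of_norm_le [CompleteSpace Y] (ha : 1 ≤ a)
    (hJ : ∀ z : ℂ, a ≤ z.re → IsPencilInverse (ContinuousLinearMap.id ℂ Y) G z (J z))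
    (hK : ∀ z : ℂ, a ≤ z.re → ‖J z‖ ≤ K * ‖z‖ ^ p) : GeneratesIntegratedSemigroup G := by
  have hpi := Real.pi_pos
  have hI : 0 ≤ ∫ s : ℝ, ‖laplaceDensity J (p + 2) (a + s * I)‖ :=
    integral_nonneg fun _ => norm_nonneg _
  refine ⟨p + 2, laplaceInversion J (p + 2) a, fun y => ?_,
    (2 * Real.pi)⁻¹ * (∫ s : ℝ, ‖laplaceDensity J (p + 2) (a + s * I)‖) + 1, a, by positivity,
    by linarith, fun t _ => ?_, fun l hl => ?_⟩
  · exact ((continuous_laplaceInversion ha hJ hK).clm_apply continuous_const).continuousOn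
  · refine (norm_laplaceInversion_le J (p + 2) a t).trans ?_
    gcongr
    linarith
  · have hl' : IsPencilInverse (ContinuousLinearMap.id ℂ Y) G l (J l) :=
      hJ l (by simpa using hl.le)
    refine ⟨⟨J l, hl'⟩, fun y => ?_⟩
    have hl0 : (l : ℂ) ≠ 0 := by exact_mod_cast (by linarith : (0 : ℝ) < l).ne'
    rw [hl'.resolvent_eq, integral_exp_smul_laplaceInversion ha hJ hK hl, smul_smul,
      mul_inv_cancel₀ (pow_ne_zero _ hl0), one_smul]

end Generation

/-! ### Pseudo-resolvents and radial estimates -/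

section PseudoResolvents

/-- A pseudo-resolvent on `s`: a family in a complex algebra that obeys the resolvent identity
there. The elements `(l • E - A)⁻¹ E` and `E (l • E - A)⁻¹` are examples. -/
def IsPseudoResolvent {R : Type*} [Ring R] [Algebra ℂ R] (J : ℂ → R) (s : Set ℂ) : Prop :=
  ∀ l ∈ s, ∀ m ∈ s, J l - J m = (m - l) • (J m * J l)

namespace IsPseudoResolvent

section Algebra

variable {R : Type*} [Ring R] [Algebra ℂ R] {J : ℂ → R} {s : Set ℂ} {l m : ℂ}

theorem commute (h : IsPseudoResolvent J s) (hl : l ∈ s) (hm : m ∈ s) :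
    Commute (J l) (J m) := by
  rcases eq_or_ne l m with rfl | hne
  · exact Commute.refl _
  · have h1 := h l hl m hm
    have h2 := h m hm l hl
    rw [← neg_sub (J l), ← neg_sub m l, neg_smul, neg_inj, h1] at h2
    exact (smul_right_injective R (sub_ne_zero.2 hne.symm) h2).symm

theorem eq_mul (h : IsPseudoResolvent J s) (hl : l ∈ s) (hm : m ∈ s) :
    J l = J m * (1 + (m - l) • J l) := by
  rw [mul_add, mul_one, mul_smul_comm, ← h l hl m hm]
  abel

theorem commute_one_add (h : IsPseudoResolvent J s) (hl : l ∈ s) (hm : m ∈ s) (c : ℂ) :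
    Commute (1 + c • J l) (J m) :=
  (Commute.one_left _).add_left ((h.commute hl hm).smul_left c)

/-- Products of `n` values of a pseudo-resolvent agree up to commuting factors, so all of them
have the same kernel and the same range. -/
theorem exists_prod_eq (h : IsPseudoResolvent J s) (hm : m ∈ s) (ls : List ℂ)
    (hls : ∀ l ∈ ls, l ∈ s) : ∃ U V : R, (∀ z ∈ s, Commute U (J z)) ∧ (∀ z ∈ s, Commute V (J z)) ∧
      (ls.map J).prod = J m ^ ls.length * U ∧ J m ^ ls.length = (ls.map J).prod * V := by
  induction ls with
  | nil => exact ⟨1, 1, fun _ _ => Commute.one_left _, fun _ _ => Commute.one_left _, by simp⟩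
  | cons l ls ih =>
    obtain ⟨U, V, hU, hV, h1, h2⟩ := ih fun z hz => hls z (List.mem_cons_of_mem _ hz)
    have hl : l ∈ s := hls l List.mem_cons_self
    have hv : Commute (1 + (l - m) • J m) (ls.map J).prod :=
      Commute.list_prod_right _ _ fun x hx => by
        obtain ⟨z, hz, rfl⟩ := List.mem_map.1 hx
        exact h.commute_one_add hm (hls z (List.mem_cons_of_mem _ hz)) _
    refine ⟨(1 + (m - l) • J l) * U, (1 + (l - m) • J m) * V,
      fun z hz => (h.commute_one_add hl hz _).mul_left (hU z hz),
      fun z hz => (h.commute_one_add hm hz _).mul_left (hV z hz), ?_, ?_⟩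
    · have hw := ((h.commute_one_add hl hm (m - l)).pow_right ls.length).eq
      rw [List.map_cons, List.prod_cons, h1, List.length_cons, pow_succ', mul_assoc (J m),
        ← mul_assoc (J m ^ _), ← hw, mul_assoc (1 + _), ← mul_assoc (J m), ← h.eq_mul hl hm]
    · rw [List.map_cons, List.prod_cons, List.length_cons, pow_succ', h2]
      nth_rewrite 1 [h.eq_mul hm hl]
      rw [mul_assoc, mul_assoc, ← mul_assoc _ _ V, hv.eq, mul_assoc]

end Algebra

section Norm

open Filter Topology

variable {R : Type*} [NormedRing R] {J : ℂ → R} {ω C : ℝ} {p : ℕ}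

/-- The estimate in the definition of the radiality index, for products over lists. -/
def IsRadial (J : ℂ → R) (ω C : ℝ) (p : ℕ) : Prop :=
  ∀ ls : List ℂ, ls.length = p + 1 → (∀ l ∈ ls, ω < l.re) →
    ‖(ls.map J).prod‖ ≤ C / (ls.map fun z => ‖z - (ω : ℂ)‖).prod

theorem IsRadial.norm_pow_mul_pow_le (hb : IsRadial J ω C p) {l m : ℂ} (hl : ω < l.re)
    (hm : ω < m.re) {j k : ℕ} (hjk : j + k = p + 1) :
    ‖J l ^ j * J m ^ k‖ ≤ C / (‖l - ω‖ ^ j * ‖m - ω‖ ^ k) := by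
  have := hb (List.replicate j l ++ List.replicate k m) (by simpa using hjk) (by
    intro z hz
    rcases List.mem_append.1 hz with hz | hz
    · rwa [List.eq_of_mem_replicate hz]
    · rwa [List.eq_of_mem_replicate hz])
  simpa using this

variable [NormedAlgebra ℂ R]

/-- Iterating `J z J mʲ = J mʲ⁺¹ - (z - m) J z J mʲ⁺¹`, each step down from the bounded
`J z J mᵖ` costs one power of `‖z‖`. -/
theorem exists_norm_le_mul_pow (h : IsPseudoResolvent J {z | ω < z.re}) (hω : 0 < ω)
    (hC : 0 < C) (hb : IsRadial J ω C p) :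
    ∃ K : ℝ, ∀ z : ℂ, ω + 1 ≤ z.re → ‖J z‖ ≤ K * ‖z‖ ^ p := by
  set m : ℂ := ((ω + 1 : ℝ) : ℂ) with hm
  have hmre : m.re = ω + 1 := rfl
  have hmn : ‖m‖ = ω + 1 := by rw [hm, Complex.norm_real, Real.norm_of_nonneg (by linarith)]
  have hmω : ‖m - ω‖ = 1 := by rw [hm]; simp
  have hz1 : ∀ z : ℂ, ω + 1 ≤ z.re → ω + 1 ≤ ‖z‖ := fun z hz =>
    hz.trans ((le_abs_self _).trans (Complex.abs_re_le_norm z))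
  -- Descending induction on the exponent `p - k` of `J m`; the radial estimate is the case `k = 0`.
  have key : ∀ k ≤ p, ∃ K : ℝ, 0 ≤ K ∧
      ∀ z : ℂ, ω + 1 ≤ z.re → ‖J z * J m ^ (p - k)‖ ≤ K * ‖z‖ ^ k := by
    intro k
    induction k with
    | zero =>
      refine fun _ => ⟨C, hC.le, fun z hz => ?_⟩
      have h1 := hb.norm_pow_mul_pow_le (l := z) (m := m) (j := 1) (k := p) (by linarith)
        (by linarith) (add_comm _ _)
      rw [hmω, one_pow, mul_one, pow_one, pow_one] at h1
      simp only [tsub_zero, pow_zero, mul_one]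
      refine h1.trans (div_le_self hC.le ?_)
      refine le_trans ?_ ((le_abs_self _).trans (Complex.abs_re_le_norm _))
      simp only [Complex.sub_re, Complex.ofReal_re]
      linarith
    | succ k ih =>
      intro hk
      obtain ⟨K, hK0, hK⟩ := ih (by lia)
      refine ⟨‖J m ^ (p - k)‖ + 2 * K, by positivity, fun z hz => ?_⟩
      have hstep : J z * J m ^ (p - (k + 1)) =
          J m ^ (p - k) + (m - z) • (J z * J m ^ (p - k)) := by
        rw [show p - k = p - (k + 1) + 1 by lia, pow_succ', ← mul_assoc,
          (h.commute (l := z) (m := m) (by simp only [Set.mem_ofPred_eq]; linarith)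
            (by simp only [Set.mem_ofPred_eq]; linarith)).eq, ← smul_mul_assoc, ← add_mul,
          ← h z (by simp only [Set.mem_ofPred_eq]; linarith) m
            (by simp only [Set.mem_ofPred_eq]; linarith), add_sub_cancel]
      have hz0 := hz1 z hz
      have hzz : ‖m - z‖ ≤ 2 * ‖z‖ := (norm_sub_le _ _).trans (by linarith)
      have hp1 : 1 ≤ ‖z‖ ^ (k + 1) := one_le_pow₀ (by linarith)
      rw [hstep]
      calc ‖J m ^ (p - k) + (m - z) • (J z * J m ^ (p - k))‖
          ≤ ‖J m ^ (p - k)‖ + ‖m - z‖ * ‖J z * J m ^ (p - k)‖ :=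
            (norm_add_le _ _).trans (by rw [norm_smul])
        _ ≤ ‖J m ^ (p - k)‖ * ‖z‖ ^ (k + 1) + 2 * ‖z‖ * (K * ‖z‖ ^ k) := by
            gcongr
            · exact le_mul_of_one_le_right (norm_nonneg _) hp1
            · exact hK z hz
        _ = (‖J m ^ (p - k)‖ + 2 * K) * ‖z‖ ^ (k + 1) := by ring
  obtain ⟨K, -, hK⟩ := key p le_rfl
  exact ⟨K, fun z hz => by simpa using hK z hz⟩

/-- With `m = ω + 1` and `l = m + n + 1`, the elements `((l - m) J l)ᵖ⁺¹` are bounded multiples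
`T U` of `T = J mᵖ⁺¹`, and they approximate the identity on the range of `T` since
`(l - m) J l J m = J m - J l`. -/
theorem exists_approximate_identity (h : IsPseudoResolvent J {z | ω < z.re})
    (hC : 0 < C) (hb : IsRadial J ω C p) :
    ∃ U : ℕ → R, (∀ n, Commute (J ((ω + 1 : ℝ) : ℂ) ^ (p + 1)) (U n)) ∧
      (∀ n, ‖J ((ω + 1 : ℝ) : ℂ) ^ (p + 1) * U n‖ ≤ C) ∧
      Tendsto (fun n => J ((ω + 1 : ℝ) : ℂ) ^ (p + 1) * U n * J ((ω + 1 : ℝ) : ℂ) ^ (p + 1)) atTop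
        (𝓝 (J ((ω + 1 : ℝ) : ℂ) ^ (p + 1))) := by
  set m : ℂ := ((ω + 1 : ℝ) : ℂ) with hm
  set l : ℕ → ℂ := fun n => ((ω + 1 + (n + 1) : ℝ) : ℂ) with hl
  have hms : m ∈ {z : ℂ | ω < z.re} := by simp [hm]
  have hls : ∀ n, l n ∈ {z : ℂ | ω < z.re} := fun n => by
    simp only [hl, Set.mem_ofPred_eq, Complex.ofReal_re]
    have : (0 : ℝ) ≤ n := n.cast_nonneg
    linarith
  have hlm : ∀ n, l n - m = ((n + 1 : ℝ) : ℂ) := fun n => by simp only [hl, hm]; push_cast; ring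
  have hmω : ‖m - ω‖ = 1 := by rw [hm]; simp
  have hlω : ∀ n, ‖l n - ω‖ = n + 2 := fun n => by
    have : l n - ω = ((n + 2 : ℝ) : ℂ) := by simp only [hl]; push_cast; ring
    rw [this, Complex.norm_real, Real.norm_of_nonneg (by positivity)]
  have hbound : ∀ n j k, j + k = p + 1 → ‖J (l n) ^ j * J m ^ k‖ ≤ C / (n + 2) ^ j :=
    fun n j k hjk => by
      simpa [hmω, hlω] using hb.norm_pow_mul_pow_le (hls n) hms hjk
  set u : ℕ → R := fun n => (l n - m) • (1 + (m - l n) • J (l n)) with hu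
  have hcomm : ∀ n, Commute (J m) (u n) := fun n =>
    ((h.commute_one_add (hls n) hms _).smul_left _).symm
  have hmu : ∀ n, J m * u n = (l n - m) • J (l n) := fun n => by
    rw [hu, mul_smul_comm, ← h.eq_mul (hls n) hms]
  have hTU : ∀ n, J m ^ (p + 1) * u n ^ (p + 1) = ((l n - m) • J (l n)) ^ (p + 1) := fun n => by
    rw [← (hcomm n).mul_pow, hmu]
  refine ⟨fun n => u n ^ (p + 1), fun n => (hcomm n).pow_pow _ _, fun n => ?_, ?_⟩
  · have h1 := hbound n (p + 1) 0 rfl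
    rw [pow_zero, mul_one] at h1
    rw [hTU, smul_pow, norm_smul, hlm, norm_pow, Complex.norm_real,
      Real.norm_of_nonneg (by positivity)]
    calc ((n : ℝ) + 1) ^ (p + 1) * ‖J (l n) ^ (p + 1)‖
        ≤ ((n : ℝ) + 2) ^ (p + 1) * (C / (n + 2) ^ (p + 1)) := by gcongr; linarith
      _ = C := by field_simp
  · have hTUT : ∀ n, J m ^ (p + 1) * u n ^ (p + 1) * J m ^ (p + 1) =
        ∑ k ∈ Finset.range (p + 2), (-J (l n)) ^ k * J m ^ (p + 1 - k) * ((p + 1).choose k : R) :=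
      fun n => by
        have hc := h.commute (hls n) hms
        rw [hTU, ← (hc.smul_left _).mul_pow, smul_mul_assoc, hc.eq, ← neg_sub m, neg_smul,
          ← h (l n) (hls n) m hms, ← hc.neg_left.add_pow]
        congr 1
        abel
    simp_rw [hTUT]
    have hlim : J m ^ (p + 1) = ∑ k ∈ Finset.range (p + 2), if k = 0 then J m ^ (p + 1) else 0 := by
      simp
    rw [hlim]
    refine tendsto_finsetSum _ fun k hk => ?_
    rcases Nat.eq_zero_or_pos k with rfl | hk0
    · simp
    · rw [if_neg hk0.ne']
      have hkp : k + (p + 1 - k) = p + 1 := by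
        have := Finset.mem_range.1 hk
        lia
      have h0 : Tendsto (fun n => J (l n) ^ k * J m ^ (p + 1 - k)) atTop (𝓝 0) := by
        refine squeeze_zero_norm (fun n => hbound n k _ hkp) ?_
        refine Tendsto.const_div_atTop ?_ _
        exact (tendsto_pow_atTop hk0.ne').comp
          (tendsto_atTop_add_const_right _ _ tendsto_natCast_atTop_atTop)
      have h1 := (h0.const_mul ((-1) ^ k)).mul_const ((p + 1).choose k : R)
      rw [mul_zero, zero_mul] at h1
      refine h1.congr fun n => ?_
      rw [neg_pow (J (l n)), mul_assoc ((-1) ^ k) (J (l n) ^ k)]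

end Norm

end IsPseudoResolvent

end PseudoResolvents

/-! ### Mean ergodic decomposition -/

section MeanErgodic

open Filter Topology

section Normed

variable {V : Type*} [NormedAddCommGroup V] [NormedSpace ℂ V] {T : V →L[ℂ] V}
  {U : ℕ → V →L[ℂ] V} {M : ℝ}

/-- The bounded operators `T U n` converge strongly to the identity on the closure of the range of
`T`: they do so on the range, and uniform boundedness carries this to the closure. -/
theorem tendsto_apply_of_mem_closure_range (hM : ∀ n, ‖T * U n‖ ≤ M)
    (hT : Tendsto (fun n => T * U n * T) atTop (𝓝 T)) {x : V}
    (hx : x ∈ (LinearMap.range (T : V →ₗ[ℂ] V)).topologicalClosure) :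
    Tendsto (fun n => (T * U n) x) atTop (𝓝 x) := by
  have hM0 : 0 ≤ M := (norm_nonneg _).trans (hM 0)
  rw [Metric.tendsto_atTop]
  intro ε hε
  obtain ⟨_, ⟨w, rfl⟩, hw⟩ := Metric.mem_closure_iff.1 hx (ε / (2 * (M + 1))) (by positivity)
  have hlim : Tendsto (fun n => (T * U n * T) w) atTop (𝓝 (T w)) :=
    ((ContinuousLinearMap.apply ℂ V w).continuous.tendsto T).comp hT
  obtain ⟨N, hN⟩ := Metric.tendsto_atTop.1 hlim (ε / 2) (by positivity)
  refine ⟨N, fun n hn => ?_⟩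
  have h1 := hN n hn
  rw [dist_eq_norm] at h1 hw ⊢
  have h2 : ‖(T * U n) (x - T w)‖ ≤ M * ‖x - T w‖ :=
    ((T * U n).le_opNorm _).trans (by gcongr; exact hM n)
  have h3 : (M + 1) * ‖x - T w‖ < ε / 2 := by
    calc (M + 1) * ‖x - T w‖ < (M + 1) * (ε / (2 * (M + 1))) := by gcongr; exact hw
      _ = ε / 2 := by field_simp
  calc ‖(T * U n) x - x‖
      = ‖(T * U n) (x - T w) + (((T * U n * T) w - T w) - (x - T w))‖ := by
        congr 1
        rw [map_sub]
        change _ = (T * U n) x - (T * U n) (T w) + ((T * U n) (T w) - T w - (x - T w))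
        abel
    _ ≤ M * ‖x - T w‖ + (‖(T * U n * T) w - T w‖ + ‖x - T w‖) :=
        (norm_add_le _ _).trans (add_le_add h2 (norm_sub_le _ _))
    _ < ε := by linarith

/-- The component along the closed range is controlled by the sum: `T U n` annihilates the kernel of
`T` and tends to the identity on the closed range. -/
theorem norm_le_mul_norm_add (hc : ∀ n, Commute T (U n)) (hM : ∀ n, ‖T * U n‖ ≤ M)
    (hT : Tendsto (fun n => T * U n * T) atTop (𝓝 T)) {x y : V}
    (hx : x ∈ (LinearMap.range (T : V →ₗ[ℂ] V)).topologicalClosure)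
    (hy : y ∈ LinearMap.ker (T : V →ₗ[ℂ] V)) : ‖x‖ ≤ M * ‖x + y‖ := by
  have hy' : T y = 0 := hy
  refine le_of_tendsto (tendsto_apply_of_mem_closure_range hM hT hx).norm (.of_forall fun n => ?_)
  have h0 : (T * U n) y = 0 := by
    rw [(hc n).eq]
    change U n (T y) = 0
    rw [hy', map_zero]
  calc ‖(T * U n) x‖ = ‖(T * U n) (x + y)‖ := by rw [map_add, h0, add_zero]
    _ ≤ M * ‖x + y‖ := ((T * U n).le_opNorm _).trans (by gcongr; exact hM n)

theorem disjoint_closure_range_ker (hc : ∀ n, Commute T (U n)) (hM : ∀ n, ‖T * U n‖ ≤ M)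
    (hT : Tendsto (fun n => T * U n * T) atTop (𝓝 T)) :
    Disjoint (LinearMap.range (T : V →ₗ[ℂ] V)).topologicalClosure
      (LinearMap.ker (T : V →ₗ[ℂ] V)) := by
  rw [Submodule.disjoint_def]
  intro x hx hx'
  have := norm_le_mul_norm_add hc hM hT hx (neg_mem hx')
  rwa [add_neg_cancel, norm_zero, mul_zero, norm_le_zero_iff] at this

end Normed

variable {H : Type*} [NormedAddCommGroup H] [InnerProductSpace ℂ H] [CompleteSpace H]
  {T : H →L[ℂ] H} {U : ℕ → H →L[ℂ] H} {M : ℝ}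

/-- A form of the mean ergodic theorem. The sum is closed because the projection onto the first
summand is bounded by `M`, and dense because its orthogonal complement
`ker T† ⊓ closure (range T†)` vanishes: the hypotheses pass to adjoints. -/
theorem isCompl_closure_range_ker (hc : ∀ n, Commute T (U n)) (hM : ∀ n, ‖T * U n‖ ≤ M)
    (hT : Tendsto (fun n => T * U n * T) atTop (𝓝 T)) :
    IsCompl (LinearMap.range (T : H →ₗ[ℂ] H)).topologicalClosure
      (LinearMap.ker (T : H →ₗ[ℂ] H)) := by
  have hM0 : 0 ≤ M := (norm_nonneg _).trans (hM 0)
  set X₁ := (LinearMap.range (T : H →ₗ[ℂ] H)).topologicalClosure with hX₁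
  set X₂ := LinearMap.ker (T : H →ₗ[ℂ] H) with hX₂
  refine ⟨disjoint_closure_range_ker hc hM hT, codisjoint_iff.2 ?_⟩
  have : CompleteSpace X₁ := by
    rw [hX₁]; infer_instance
  have : CompleteSpace X₂ := (ContinuousLinearMap.isClosed_ker T).completeSpace_coe
  have hclosed : IsClosed ((X₁ ⊔ X₂ : Submodule ℂ H) : Set H) := by
    -- On the product with the sup norm the sum map is bounded below by `(M + 1)⁻¹`.
    have hanti : AntilipschitzWith (M + 1).toNNReal (X₁.subtypeL.coprod X₂.subtypeL) := by
      refine ContinuousLinearMap.antilipschitz_of_bound _ fun q => ?_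
      rw [Real.coe_toNNReal _ (by linarith)]
      have h1 : ‖(q.1 : H)‖ ≤ M * ‖(q.1 : H) + q.2‖ := norm_le_mul_norm_add hc hM hT q.1.2 q.2.2
      have h2 : ‖(q.2 : H)‖ ≤ ‖(q.1 : H) + q.2‖ + ‖(q.1 : H)‖ := by
        simpa using norm_sub_le ((q.1 : H) + q.2) q.1
      have h3 := norm_nonneg ((q.1 : H) + q.2)
      refine max_le ?_ ?_
      · change ‖(q.1 : H)‖ ≤ (M + 1) * ‖(q.1 : H) + q.2‖
        linarith
      · change ‖(q.2 : H)‖ ≤ (M + 1) * ‖(q.1 : H) + q.2‖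
        linarith
    have hr := hanti.isClosed_range (X₁.subtypeL.coprod X₂.subtypeL).uniformContinuous
    convert hr
    ext x
    simp [Submodule.mem_sup]
  rw [← hclosed.submodule_topologicalClosure_eq, Submodule.topologicalClosure_eq_top_iff,
    ← Submodule.inf_orthogonal, hX₁, Submodule.orthogonal_closure, hX₂,
    ContinuousLinearMap.orthogonal_range, ContinuousLinearMap.orthogonal_ker, inf_comm]
  refine (disjoint_closure_range_ker (T := star T) (U := fun n => star (U n)) (M := M)
    (fun n => ?_) (fun n => ?_) ?_).eq_bot
  · rw [commute_iff_eq, ← star_mul, ← star_mul, (hc n).eq]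
  · rw [← star_mul, norm_star, ← (hc n).eq]
    exact hM n
  · refine ((continuous_star.tendsto T).comp hT).congr fun n => ?_
    simp only [Function.comp, star_mul, mul_assoc]

end MeanErgodic

/-! ### Splitting a pencil along invariant subspaces -/

section PencilInverse

variable {X Z : Type*} [NormedAddCommGroup X] [NormedSpace ℂ X]
  [NormedAddCommGroup Z] [NormedSpace ℂ Z] {E : X →L[ℂ] Z} {A : X →ₗ.[ℂ] Z} {l : ℂ}
  {B : Z →L[ℂ] X}

theorem IsPencilInverse.mem_domain (h : IsPencilInverse E A l B) (z : Z) : B z ∈ A.domain :=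
  (h.1 z).choose

theorem IsPencilInverse.apply_mk (h : IsPencilInverse E A l B) (z : Z) (hz : B z ∈ A.domain) :
    A ⟨B z, hz⟩ = l • E (B z) - z :=
  eq_sub_of_add_eq' (sub_eq_iff_eq_add.1 (h.1 z).choose_spec).symm

theorem IsPencilInverse.exists_eq (h : IsPencilInverse E A l B) (x : A.domain) :
    ∃ z, B z = x ∧ A x = l • E (x : X) - z :=
  ⟨l • E (x : X) - A x, h.2 x, by abel⟩

theorem IsPencilInverse.eq_zero (h : IsPencilInverse E A l B) {z : Z} (hz : B z = 0) : z = 0 := by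
  have h1 := h.apply_mk z (h.mem_domain z)
  have h2 : (⟨B z, h.mem_domain z⟩ : A.domain) = 0 := Subtype.ext hz
  rw [h2, LinearPMap.map_zero, hz, map_zero, smul_zero, zero_sub] at h1
  exact neg_eq_zero.1 h1.symm

end PencilInverse

section Submodules

variable {X Z : Type*} [AddCommGroup X] [Module ℂ X] [AddCommGroup Z] [Module ℂ Z]

theorem eq_and_eq_of_add_eq_add {U₁ U₂ : Submodule ℂ X} (h : Disjoint U₁ U₂) {x x' y y' : X}
    (hx : x ∈ U₁) (hx' : x' ∈ U₁) (hy : y ∈ U₂) (hy' : y' ∈ U₂) (heq : x + y = x' + y') :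
    x = x' ∧ y = y' := by
  have h1 : x - x' = y' - y := by
    rw [sub_eq_sub_iff_add_eq_add, heq, add_comm]
  have h2 : x - x' = 0 :=
    Submodule.disjoint_def.1 h _ (sub_mem hx hx') (h1 ▸ sub_mem hy' hy)
  exact ⟨sub_eq_zero.1 h2, (sub_eq_zero.1 (h1 ▸ h2)).symm⟩

theorem exists_add_eq {U₁ U₂ : Submodule ℂ X} (h : IsCompl U₁ U₂) (x : X) :
    ∃ x₁ ∈ U₁, ∃ x₂ ∈ U₂, x₁ + x₂ = x :=
  Submodule.mem_sup.1 (h.sup_eq_top ▸ Submodule.mem_top)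

/-- An injective block diagonal map reflects membership in the blocks. -/
theorem mem_of_apply_mem {U₁ U₂ : Submodule ℂ X} {V₁ V₂ : Submodule ℂ Z} (hU : Disjoint U₁ U₂)
    (hV : IsCompl V₁ V₂) {B : Z →ₗ[ℂ] X} (hB : ∀ z, B z = 0 → z = 0) (h₁ : ∀ z ∈ V₁, B z ∈ U₁)
    (h₂ : ∀ z ∈ V₂, B z ∈ U₂) {z : Z} (hz : B z ∈ U₁) : z ∈ V₁ := by
  obtain ⟨z₁, hz₁, z₂, hz₂, rfl⟩ := exists_add_eq hV z
  have := (eq_and_eq_of_add_eq_add hU (h₁ z₁ hz₁) hz (h₂ z₂ hz₂) (zero_mem _)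
    (by rw [add_zero, map_add])).2
  rwa [hB z₂ this, add_zero]

end Submodules

section Intertwining

variable {X Z : Type*} [NormedAddCommGroup X] [NormedSpace ℂ X]
  [NormedAddCommGroup Z] [NormedSpace ℂ Z] {F : X →L[ℂ] Z} {T : X →L[ℂ] X} {T' : Z →L[ℂ] Z}

theorem apply_pow_apply (h : ∀ x, F (T x) = T' (F x)) (n : ℕ) (x : X) :
    F ((T ^ n) x) = (T' ^ n) (F x) := by
  induction n generalizing x with
  | zero => rfl
  | succ n ih =>
    rw [pow_succ, pow_succ]
    change F ((T ^ n) (T x)) = (T' ^ n) (T' (F x))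
    rw [ih, h]

/-- An intertwiner of `T` and `T'` maps the closed range of `T` into that of `T'`. -/
theorem apply_mem_closure_range (h : ∀ x, F (T x) = T' (F x)) {x : X}
    (hx : x ∈ (LinearMap.range (T : X →ₗ[ℂ] X)).topologicalClosure) :
    F x ∈ (LinearMap.range (T' : Z →ₗ[ℂ] Z)).topologicalClosure :=
  map_mem_closure F.continuous hx fun _ ⟨w, hw⟩ => ⟨F w, by rw [← hw]; exact (h w).symm⟩

theorem apply_mem_ker (h : ∀ x, F (T x) = T' (F x)) {x : X}
    (hx : x ∈ LinearMap.ker (T : X →ₗ[ℂ] X)) : F x ∈ LinearMap.ker (T' : Z →ₗ[ℂ] Z) := by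
  have hx' : T x = 0 := hx
  change T' (F x) = 0
  rw [← h, hx', map_zero]

theorem isNilpotent_comp_swap {F : X →L[ℂ] Z} {G : Z →L[ℂ] X} (h : IsNilpotent (F ∘L G)) :
    IsNilpotent (G ∘L F) := by
  obtain ⟨n, hn⟩ := h
  refine ⟨n + 1, ?_⟩
  ext x
  rw [pow_succ']
  change G (F (((G ∘L F) ^ n) x)) = 0
  rw [apply_pow_apply (F := F) (T := G ∘L F) (T' := F ∘L G) (fun _ => rfl), hn]
  simp

end Intertwining

section Construction

variable {X Z : Type*} [NormedAddCommGroup X] [NormedSpace ℂ X]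
  [NormedAddCommGroup Z] [NormedSpace ℂ Z] {E : X →L[ℂ] Z} {A : X →ₗ.[ℂ] Z}
  {U U₁ U₂ : Submodule ℂ X} {V V₁ V₂ : Submodule ℂ Z}

/-- The restriction of `A` to `D(A) ∩ U`, when it takes values in `V`. -/
def part (A : X →ₗ.[ℂ] Z) (h : ∀ x : A.domain, (x : X) ∈ U → A x ∈ V) : U →ₗ.[ℂ] V where
  domain := A.domain.comap U.subtype
  toFun :=
    { toFun := fun u => ⟨A ⟨u.1, u.2⟩, h ⟨u.1, u.2⟩ u.1.2⟩
      map_add' := fun u v => Subtype.ext (A.map_add ⟨u.1, u.2⟩ ⟨v.1, v.2⟩)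
      map_smul' := fun c u => Subtype.ext (A.map_smul c ⟨u.1, u.2⟩) }

theorem isPart_part (h : ∀ x : A.domain, (x : X) ∈ U → A x ∈ V) : IsPart A (part A h) :=
  ⟨fun _ => Iff.rfl, fun u x hux => congrArg A (Subtype.ext hux : (⟨u.1, u.2⟩ : A.domain) = x)⟩

/-- Decompositions that are respected by `E` and by one resolvent `B = (l • E - A)⁻¹` split the
pencil. As `A B = l E B - 1`, the inverse of `A₂` is `-B (1 - l E B)⁻¹`, and nilpotency of `E B`
on `V₂` makes the Neumann series of `(1 - l E B)⁻¹` a finite sum. -/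
theorem nonempty_weierstrassSplitting [CompleteSpace U₁] [CompleteSpace V₁]
    {l : ℂ} {B : Z →L[ℂ] X} (hB : IsPencilInverse E A l B)
    (hU : IsCompl U₁ U₂) (hV : IsCompl V₁ V₂)
    (hE₁ : ∀ x ∈ U₁, E x ∈ V₁) (hE₂ : ∀ x ∈ U₂, E x ∈ V₂)
    (hB₁ : ∀ z ∈ V₁, B z ∈ U₁) (hB₂ : ∀ z ∈ V₂, B z ∈ U₂)
    (hinj : ∀ x ∈ U₁, E x = 0 → x = 0) (hsurj : ∀ z ∈ V₁, ∃ x ∈ U₁, E x = z)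
    {N : ℕ} (hN : ∀ z ∈ V₂, ((E ∘L B) ^ N) z = 0) :
    Nonempty (WeierstrassSplitting E A U₁ U₂ V₁ V₂) := by
  have hpre₁ : ∀ z, B z ∈ U₁ → z ∈ V₁ := fun z hz =>
    mem_of_apply_mem (B := (B : Z →ₗ[ℂ] X)) hU.disjoint hV (fun _ => hB.eq_zero) hB₁ hB₂ hz
  have hpre₂ : ∀ z, B z ∈ U₂ → z ∈ V₂ := fun z hz =>
    mem_of_apply_mem (B := (B : Z →ₗ[ℂ] X)) hU.disjoint.symm hV.symm (fun _ => hB.eq_zero)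
      hB₂ hB₁ hz
  have hA₁ : ∀ x : A.domain, (x : X) ∈ U₁ → A x ∈ V₁ := fun x hx => by
    obtain ⟨z, hz, hAx⟩ := hB.exists_eq x
    rw [hAx]
    exact sub_mem (V₁.smul_mem _ (hE₁ _ hx)) (hpre₁ z (hz ▸ hx))
  have hA₂ : ∀ x : A.domain, (x : X) ∈ U₂ → A x ∈ V₂ := fun x hx => by
    obtain ⟨z, hz, hAx⟩ := hB.exists_eq x
    rw [hAx]
    exact sub_mem (V₂.smul_mem _ (hE₂ _ hx)) (hpre₂ z (hz ▸ hx))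
  set Q : Z →L[ℂ] Z := E ∘L B with hQ
  have hQ₂ : ∀ z ∈ V₂, Q z ∈ V₂ := fun z hz => hE₂ _ (hB₂ z hz)
  have hQpow : ∀ k : ℕ, ∀ z ∈ V₂, ((l • Q) ^ k) z ∈ V₂ := fun k => by
    induction k with
    | zero => exact fun z hz => hz
    | succ k ih =>
      intro z hz
      rw [pow_succ]
      exact ih _ (V₂.smul_mem _ (hQ₂ z hz))
  set S : Z →L[ℂ] Z := ∑ k ∈ Finset.range N, (l • Q) ^ k with hS
  have hS₂ : ∀ z ∈ V₂, S z ∈ V₂ := fun z hz => by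
    rw [hS, sum_apply]
    exact sum_mem fun k _ => hQpow k z hz
  have hlQN : ∀ z ∈ V₂, ((l • Q) ^ N) z = 0 := fun z hz => by
    rw [smul_pow, smul_apply, hN z hz, smul_zero]
  have hSl : ∀ z ∈ V₂, S z - l • Q (S z) = z := fun z hz => by
    have h := congrArg (fun f : Z →L[ℂ] Z => f z) (mul_neg_geom_sum (l • Q) N)
    change S z - l • Q (S z) = z - ((l • Q) ^ N) z at h
    rwa [hlQN z hz, sub_zero] at h
  have hSr : ∀ z ∈ V₂, S (z - l • Q z) = z := fun z hz => by
    have h := congrArg (fun f : Z →L[ℂ] Z => f z) (geom_sum_mul_neg (l • Q) N)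
    change S (z - l • Q z) = z - ((l • Q) ^ N) z at h
    rwa [hlQN z hz, sub_zero] at h
  have hcomm : Commute Q S := Commute.sum_right _ _ _ fun k _ =>
    ((Commute.refl Q).smul_right l).pow_right k
  -- `S` inverts `1 - l • Q` on `V₂`, so `D = -B S` is the candidate for `A₂⁻¹`.
  set D : V₂ →L[ℂ] U₂ := (-(B ∘L S)).restrict
    (fun z hz => U₂.neg_mem (hB₂ _ (hS₂ z hz))) with hD
  have hDa : ∀ z : V₂, (D z : X) = -B (S z) := fun z => rfl
  have hnil : IsNilpotent ((E.restrict hE₂ : U₂ →L[ℂ] V₂) ∘L D) := by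
    refine ⟨N, ?_⟩
    ext z
    have h1 := apply_pow_apply (F := V₂.subtypeL) (T := (E.restrict hE₂ : U₂ →L[ℂ] V₂) ∘L D)
      (T' := -S * Q) (fun z => ?_) N z
    · change ((((E.restrict hE₂ : U₂ →L[ℂ] V₂) ∘L D) ^ N) z : Z) = ((-S * Q) ^ N) z at h1
      rw [h1, hcomm.symm.neg_left.mul_pow]
      change ((-S) ^ N) ((Q ^ N) z) = _
      rw [hN z z.2, map_zero]
      rfl
    · change E (-B (S z)) = -(S * Q) z
      rw [← hcomm.eq, map_neg]
      rfl
  refine ⟨{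
    isCompl_dom := hU
    isCompl_cod := hV
    domain_splits := fun u₁ u₂ hu => ?_
    E₁ := ContinuousLinearEquiv.ofBijective (E.restrict hE₁) ?_ ?_
    E₁_apply := fun x => rfl
    E₂ := E.restrict hE₂
    E₂_apply := fun x => rfl
    A₁ := part A hA₁
    A₁_isPart := isPart_part hA₁
    A₂ := part A hA₂
    A₂_isPart := isPart_part hA₂
    A₂inv := D
    A₂_A₂inv := fun z => ?_
    A₂inv_A₂ := fun x => ?_
    isNilpotent_cod := hnil
    isNilpotent_dom := isNilpotent_comp_swap hnil }⟩
  · obtain ⟨z, hz, -⟩ := hB.exists_eq ⟨_, hu⟩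
    obtain ⟨z₁, hz₁, z₂, hz₂, rfl⟩ := exists_add_eq hV z
    obtain ⟨h1, h2⟩ := eq_and_eq_of_add_eq_add hU.disjoint (hB₁ z₁ hz₁) u₁.2 (hB₂ z₂ hz₂) u₂.2
      (by rw [← map_add]; exact hz)
    exact ⟨h1 ▸ hB.mem_domain z₁, h2 ▸ hB.mem_domain z₂⟩
  · refine LinearMap.ker_eq_bot'.2 fun x hx => Subtype.ext (hinj x x.2 ?_)
    exact congrArg Subtype.val hx
  · refine LinearMap.range_eq_top.2 fun z => ?_
    obtain ⟨x, hx, hxz⟩ := hsurj z z.2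
    exact ⟨⟨x, hx⟩, Subtype.ext hxz⟩
  · have hmem : -B (S z) ∈ A.domain := A.domain.neg_mem (hB.mem_domain _)
    refine ⟨hmem, Subtype.ext ?_⟩
    change A ⟨-B (S z), hmem⟩ = z
    have : (⟨-B (S z), hmem⟩ : A.domain) = -⟨B (S z), hB.mem_domain _⟩ := rfl
    rw [this, LinearPMap.map_neg, hB.apply_mk, neg_sub]
    exact hSl z z.2
  · obtain ⟨z, hz, hAx⟩ := hB.exists_eq ⟨x.1, x.2⟩
    refine Subtype.ext ?_
    change -B (S (A ⟨x.1, x.2⟩)) = x.1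
    have hzV : z ∈ V₂ := hpre₂ z (by rw [hz]; exact x.1.2)
    rw [hAx, ← hz]
    have : l • E (B z) - z = -(z - l • Q z) := by rw [neg_sub]; rfl
    rw [this, map_neg, hSr z hzV, map_neg, neg_neg]

end Construction

/-! ### Resolvents of the differential parts -/

section Restriction

variable {X Z : Type*} [NormedAddCommGroup X] [NormedSpace ℂ X]
  [NormedAddCommGroup Z] [NormedSpace ℂ Z] {E : X →L[ℂ] Z} {A : X →ₗ.[ℂ] Z}
  {U₁ U₂ : Submodule ℂ X} {V₁ V₂ : Submodule ℂ Z} {l : ℂ} {B : Z →L[ℂ] X}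

namespace WeierstrassSplitting

theorem E_mem (W : WeierstrassSplitting E A U₁ U₂ V₁ V₂) (x : U₁) : E (x : X) ∈ V₁ :=
  W.E₁_apply x ▸ (W.E₁ x).2

theorem A_mem_left (W : WeierstrassSplitting E A U₁ U₂ V₁ V₂)
    (x : A.domain) (hx : (x : X) ∈ U₁) : A x ∈ V₁ := by
  have h : (⟨x, hx⟩ : U₁) ∈ W.A₁.domain := (W.A₁_isPart.1 ⟨x, hx⟩).2 x.2
  exact W.A₁_isPart.2 ⟨⟨x, hx⟩, h⟩ x rfl ▸ (W.A₁ ⟨⟨x, hx⟩, h⟩).2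

theorem A_mem_right (W : WeierstrassSplitting E A U₁ U₂ V₁ V₂)
    (x : A.domain) (hx : (x : X) ∈ U₂) : A x ∈ V₂ := by
  have h : (⟨x, hx⟩ : U₂) ∈ W.A₂.domain := (W.A₂_isPart.1 ⟨x, hx⟩).2 x.2
  exact W.A₂_isPart.2 ⟨⟨x, hx⟩, h⟩ x rfl ▸ (W.A₂ ⟨⟨x, hx⟩, h⟩).2

/-- A splitting is respected by every resolvent of the pencil: the `U₂`-component of `B z` is mapped
by `l • E - A` to the `V₂`-component of `z`, which is zero for `z ∈ V₁`. -/
theorem resolvent_mem (W : WeierstrassSplitting E A U₁ U₂ V₁ V₂)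
    (hB : IsPencilInverse E A l B) {z : Z} (hz : z ∈ V₁) : B z ∈ U₁ := by
  obtain ⟨u₁, hu₁, u₂, hu₂, hu⟩ := exists_add_eq W.isCompl_dom (B z)
  obtain ⟨hd₁, hd₂⟩ := W.domain_splits ⟨u₁, hu₁⟩ ⟨u₂, hu₂⟩ (hu.symm ▸ hB.mem_domain z)
  have h1 : l • E u₁ - A ⟨u₁, hd₁⟩ ∈ V₁ :=
    sub_mem (V₁.smul_mem _ (W.E_mem ⟨u₁, hu₁⟩)) (W.A_mem_left ⟨u₁, hd₁⟩ hu₁)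
  have h2 : l • E u₂ - A ⟨u₂, hd₂⟩ ∈ V₂ :=
    sub_mem (V₂.smul_mem _ (W.E₂_apply ⟨u₂, hu₂⟩ ▸ (W.E₂ ⟨u₂, hu₂⟩).2))
      (W.A_mem_right ⟨u₂, hd₂⟩ hu₂)
  have hsum : (l • E u₁ - A ⟨u₁, hd₁⟩) + (l • E u₂ - A ⟨u₂, hd₂⟩) = z + 0 := by
    have hA : A ⟨B z, hB.mem_domain z⟩ = A ⟨u₁, hd₁⟩ + A ⟨u₂, hd₂⟩ := by
      rw [← LinearPMap.map_add]
      exact congrArg A (Subtype.ext hu.symm)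
    rw [hB.apply_mk, ← hu, map_add, smul_add] at hA
    rw [add_zero, sub_add_sub_comm, ← hA]
    abel
  have h0 := (eq_and_eq_of_add_eq_add W.isCompl_cod.disjoint h1 hz h2 (zero_mem _) hsum).2
  have h3 : B (l • E u₂ - A ⟨u₂, hd₂⟩) = u₂ := hB.2 ⟨u₂, hd₂⟩
  rw [h0, map_zero] at h3
  rw [← hu, ← h3, add_zero]
  exact hu₁

theorem E_symm (W : WeierstrassSplitting E A U₁ U₂ V₁ V₂) (v : V₁) : E (W.E₁.symm v : X) = v := by
  rw [← W.E₁_apply, ContinuousLinearEquiv.apply_symm_apply]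

/-- The resolvent of `A₁ E₁⁻¹` is the restriction of `E (l • E - A)⁻¹`. -/
theorem exists_resolvent_A₁E₁inv (W : WeierstrassSplitting E A U₁ U₂ V₁ V₂)
    (hB : IsPencilInverse E A l B) :
    ∃ B' : V₁ →L[ℂ] V₁, IsPencilInverse (ContinuousLinearMap.id ℂ V₁) W.A₁E₁inv l B' ∧
      ‖B'‖ ≤ ‖E ∘L B‖ := by
  have hmaps : ∀ z ∈ V₁, (E ∘L B) z ∈ V₁ := fun z hz => W.E_mem ⟨B z, W.resolvent_mem hB hz⟩
  refine ⟨(E ∘L B).restrict hmaps, ⟨fun z => ?_, fun x => ?_⟩, ?_⟩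
  · have hsymm : W.E₁.symm ((E ∘L B).restrict hmaps z) = ⟨B z, W.resolvent_mem hB z.2⟩ := by
      rw [ContinuousLinearEquiv.symm_apply_eq]
      exact Subtype.ext (W.E₁_apply ⟨B z, W.resolvent_mem hB z.2⟩).symm
    have hd : W.E₁.symm ((E ∘L B).restrict hmaps z) ∈ W.A₁.domain := by
      rw [hsymm, W.A₁_isPart.1]
      exact hB.mem_domain _
    refine ⟨hd, Subtype.ext ?_⟩
    have hA := W.A₁_isPart.2 ⟨_, hd⟩ ⟨B z, hB.mem_domain z⟩ (congrArg Subtype.val hsymm)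
    rw [hB.apply_mk] at hA
    change l • E (B z) - (W.A₁ ⟨_, hd⟩ : Z) = z
    rw [hA]
    abel
  · refine Subtype.ext ?_
    have hd : W.E₁.symm x.1 ∈ W.A₁.domain := x.2
    have hdA := (W.A₁_isPart.1 _).1 hd
    change E (B (l • (x.1 : Z) - (W.A₁ ⟨_, hd⟩ : Z))) = x.1
    rw [W.A₁_isPart.2 ⟨_, hd⟩ ⟨_, hdA⟩ rfl, ← W.E_symm, hB.2 ⟨_, hdA⟩]
  · exact ContinuousLinearMap.opNorm_le_bound _ (norm_nonneg _) fun z =>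
      (E ∘L B).le_opNorm (z : Z)

/-- The resolvent of `E₁⁻¹ A₁` is the restriction of `(l • E - A)⁻¹ E`. -/
theorem exists_resolvent_E₁invA₁ (W : WeierstrassSplitting E A U₁ U₂ V₁ V₂)
    (hB : IsPencilInverse E A l B) :
    ∃ B' : U₁ →L[ℂ] U₁, IsPencilInverse (ContinuousLinearMap.id ℂ U₁) W.E₁invA₁ l B' ∧
      ‖B'‖ ≤ ‖B ∘L E‖ := by
  have hmaps : ∀ x ∈ U₁, (B ∘L E) x ∈ U₁ := fun x hx => W.resolvent_mem hB (W.E_mem ⟨x, hx⟩)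
  refine ⟨(B ∘L E).restrict hmaps, ⟨fun u => ?_, fun x => ?_⟩, ?_⟩
  · have hd : (B ∘L E).restrict hmaps u ∈ W.A₁.domain :=
      (W.A₁_isPart.1 _).2 (hB.mem_domain _)
    refine ⟨hd, W.E₁.injective (Subtype.ext ?_)⟩
    have hA := W.A₁_isPart.2 ⟨_, hd⟩ ⟨B (E u), hB.mem_domain _⟩ rfl
    rw [hB.apply_mk] at hA
    change ((W.E₁ (l • (B ∘L E).restrict hmaps u - W.E₁.symm (W.A₁ ⟨_, hd⟩)) : V₁) : Z) = W.E₁ u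
    rw [map_sub, map_smul, ContinuousLinearEquiv.apply_symm_apply, Submodule.coe_sub,
      Submodule.coe_smul, W.E₁_apply, W.E₁_apply, hA]
    change l • E (B (E u)) - _ = _
    abel
  · refine Subtype.ext ?_
    have hdA := (W.A₁_isPart.1 _).1 x.2
    change B (E (l • (x.1 : X) - (W.E₁.symm (W.A₁ x) : X))) = x.1
    rw [map_sub, map_smul, W.E_symm, W.A₁_isPart.2 x ⟨_, hdA⟩ rfl, hB.2 ⟨_, hdA⟩]
  · exact ContinuousLinearMap.opNorm_le_bound _ (norm_nonneg _) fun z =>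
      (B ∘L E).le_opNorm (z : X)

end WeierstrassSplitting

theorem generatesIntegratedSemigroup_of_exists {Y : Type*} [NormedAddCommGroup Y]
    [NormedSpace ℂ Y] [CompleteSpace Y] {G : Y →ₗ.[ℂ] Y} {a K : ℝ} {p : ℕ} (ha : 1 ≤ a)
    (h : ∀ z : ℂ, a ≤ z.re → ∃ B : Y →L[ℂ] Y,
      IsPencilInverse (ContinuousLinearMap.id ℂ Y) G z B ∧ ‖B‖ ≤ K * ‖z‖ ^ p) :
    GeneratesIntegratedSemigroup G :=
  generatesIntegratedSemigroup_of_norm_le (J := resolvent (ContinuousLinearMap.id ℂ Y) G) ha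
    (fun z hz => isPencilInverse_resolvent ((h z hz).imp fun _ hB => hB.1))
    fun z hz => by
      obtain ⟨B, hB, hn⟩ := h z hz
      rwa [hB.resolvent_eq]

end Restriction

/-! ### Radial pencils -/

section Radial

variable {X Z : Type*} [NormedAddCommGroup X] [NormedSpace ℂ X]
  [NormedAddCommGroup Z] [NormedSpace ℂ Z] (E : X →L[ℂ] Z) (A : X →ₗ.[ℂ] Z)

theorem IsPseudoResolvent.mono {R : Type*} [Ring R] [Algebra ℂ R] {J : ℂ → R} {s t : Set ℂ}
    (h : IsPseudoResolvent J t) (hst : ∀ z ∈ s, z ∈ t) : IsPseudoResolvent J s :=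
  fun l hl m hm => h l (hst l hl) m (hst m hm)

theorem isPseudoResolvent_left :
    IsPseudoResolvent (fun z => resolvent E A z ∘L E) (resolventSet E A) := fun l hl m hm => by
  ext x
  exact (isPencilInverse_resolvent hl).sub_apply (isPencilInverse_resolvent hm) (E x)

theorem isPseudoResolvent_right :
    IsPseudoResolvent (fun z => E ∘L resolvent E A z) (resolventSet E A) := fun l hl m hm => by
  ext z
  have h := (isPencilInverse_resolvent hl).sub_apply (isPencilInverse_resolvent hm) z
  change E (resolvent E A l z) - E (resolvent E A m z) = (m - l) • E _
  rw [← map_sub, h, map_smul]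
  rfl

theorem leftProd_eq {p : ℕ} (lam : Fin (p + 1) → ℂ) :
    leftProd E A lam = ((List.ofFn lam).map fun z => resolvent E A z ∘L E).prod := by
  rw [leftProd, List.map_ofFn]
  rfl

theorem rightProd_eq {p : ℕ} (lam : Fin (p + 1) → ℂ) :
    rightProd E A lam = ((List.ofFn lam).map fun z => E ∘L resolvent E A z).prod := by
  rw [rightProd, List.map_ofFn]
  rfl

theorem IsPseudoResolvent.isRadial_of_ofFn {R : Type*} [NormedRing R] {J : ℂ → R} {ω C : ℝ} {p : ℕ}
    (h : ∀ lam : Fin (p + 1) → ℂ, (∀ k, ω < (lam k).re) →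
      ‖((List.ofFn lam).map J).prod‖ ≤ C / ∏ k, ‖lam k - (ω : ℂ)‖) : IsRadial J ω C p := by
  intro ls hlen hls
  generalize p + 1 = n at h hlen
  subst hlen
  have h1 := h ls.get fun k => hls _ (List.get_mem ls k)
  rw [List.ofFn_get] at h1
  convert h1
  rw [← List.prod_ofFn]
  congr 1
  conv_lhs => rw [← List.ofFn_get ls, List.map_ofFn]
  rfl

theorem IsPseudoResolvent.ker_range_prod {V : Type*} [NormedAddCommGroup V] [NormedSpace ℂ V]
    {J : ℂ → V →L[ℂ] V} {s : Set ℂ} (h : IsPseudoResolvent J s) {m : ℂ} (hm : m ∈ s) (ls : List ℂ)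
    (hls : ∀ l ∈ ls, l ∈ s) :
    LinearMap.ker ((ls.map J).prod : V →ₗ[ℂ] V) =
        LinearMap.ker ((J m ^ ls.length : V →L[ℂ] V) : V →ₗ[ℂ] V) ∧
      LinearMap.range ((ls.map J).prod : V →ₗ[ℂ] V) =
        LinearMap.range ((J m ^ ls.length : V →L[ℂ] V) : V →ₗ[ℂ] V) := by
  obtain ⟨U, V', hU, hV, h1, h2⟩ := h.exists_prod_eq hm ls hls
  have hU' : (ls.map J).prod = U * J m ^ ls.length := by rw [h1, ((hU m hm).pow_right _).eq]
  have hV' : J m ^ ls.length = V' * (ls.map J).prod := by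
    rw [h2]
    refine (Commute.list_prod_right _ _ fun x hx => ?_).eq.symm
    obtain ⟨z, hz, rfl⟩ := List.mem_map.1 hx
    exact hV z (hls z hz)
  constructor
  · ext x
    change (ls.map J).prod x = 0 ↔ (J m ^ ls.length) x = 0
    constructor <;> intro hx
    · rw [hV']
      change V' ((ls.map J).prod x) = 0
      rw [hx, map_zero]
    · rw [hU']
      change U ((J m ^ ls.length) x) = 0
      rw [hx, map_zero]
  · ext x
    constructor
    · rintro ⟨w, rfl⟩
      exact ⟨U w, congrArg (fun f : V →L[ℂ] V => f w) h1.symm⟩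
    · rintro ⟨w, rfl⟩
      exact ⟨V' w, congrArg (fun f : V →L[ℂ] V => f w) h2.symm⟩

end Radial

section Spectral

variable {X Z : Type*} [NormedAddCommGroup X] [NormedSpace ℂ X]
  [NormedAddCommGroup Z] [NormedSpace ℂ Z] {E : X →L[ℂ] Z} {A : X →ₗ.[ℂ] Z}

/-- The resolvent and `E` intertwine `(B E)ⁿ` with `(E B)ⁿ`, hence respect closed ranges and
kernels. Surjectivity of `E` onto the closure of the range of `(E B)ⁿ⁺¹` is where closedness of the
range of `E` enters. -/
theorem nonempty_weierstrassSplitting_of_isCompl [CompleteSpace X] [CompleteSpace Z]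
    (hE : IsClosed (Set.range E)) {l : ℂ}
    {B : Z →L[ℂ] X} (hB : IsPencilInverse E A l B) (n : ℕ) {P : X →L[ℂ] X} {Q : Z →L[ℂ] Z}
    (hP : P = (B ∘L E) ^ (n + 1)) (hQ : Q = (E ∘L B) ^ (n + 1))
    (hU : IsCompl (LinearMap.range (P : X →ₗ[ℂ] X)).topologicalClosure
      (LinearMap.ker (P : X →ₗ[ℂ] X)))
    (hV : IsCompl (LinearMap.range (Q : Z →ₗ[ℂ] Z)).topologicalClosure
      (LinearMap.ker (Q : Z →ₗ[ℂ] Z))) :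
    Nonempty (WeierstrassSplitting E A (LinearMap.range (P : X →ₗ[ℂ] X)).topologicalClosure
      (LinearMap.ker (P : X →ₗ[ℂ] X)) (LinearMap.range (Q : Z →ₗ[ℂ] Z)).topologicalClosure
      (LinearMap.ker (Q : Z →ₗ[ℂ] Z))) := by
  have hEP : ∀ x, E (P x) = Q (E x) := by
    rw [hP, hQ]
    exact apply_pow_apply (F := E) (T := B ∘L E) (T' := E ∘L B) (fun _ => rfl) _
  have hBQ : ∀ z, B (Q z) = P (B z) := by
    rw [hP, hQ]
    exact apply_pow_apply (F := B) (T := E ∘L B) (T' := B ∘L E) (fun _ => rfl) _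
  have hE₁ : ∀ x ∈ (LinearMap.range (P : X →ₗ[ℂ] X)).topologicalClosure,
      E x ∈ (LinearMap.range (Q : Z →ₗ[ℂ] Z)).topologicalClosure :=
    fun x hx => apply_mem_closure_range hEP hx
  have hE₂ : ∀ x ∈ LinearMap.ker (P : X →ₗ[ℂ] X), E x ∈ LinearMap.ker (Q : Z →ₗ[ℂ] Z) :=
    fun x hx => apply_mem_ker hEP hx
  refine nonempty_weierstrassSplitting hB hU hV hE₁ hE₂
    (fun z hz => apply_mem_closure_range hBQ hz) (fun z hz => apply_mem_ker hBQ hz)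
    (fun x hx hx0 => Submodule.disjoint_def.1 hU.disjoint x hx ?_) (fun z hz => ?_)
    (N := n + 1) fun z hz => by rw [← hQ]; exact hz
  -- `E x = 0` puts `x` into the kernel of `(B E)ⁿ⁺¹`, which meets its closed range trivially.
  · change P x = 0
    rw [hP, pow_succ]
    change ((B ∘L E) ^ n) (B (E x)) = 0
    rw [hx0, map_zero, map_zero]
  · have hran : (LinearMap.range (Q : Z →ₗ[ℂ] Z)).topologicalClosure ≤
        LinearMap.range (E : X →ₗ[ℂ] Z) := by
      refine Submodule.topologicalClosure_minimal _ ?_ hE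
      rintro _ ⟨w, rfl⟩
      rw [hQ, pow_succ']
      exact ⟨B (((E ∘L B) ^ n) w), rfl⟩
    obtain ⟨x, hx⟩ := hran hz
    -- Only the component of the preimage in the closed range of `(B E)ⁿ⁺¹` is kept: its other
    -- component is mapped into `ker Q`, so contributes zero.
    obtain ⟨x₁, hx₁, x₂, hx₂, rfl⟩ := exists_add_eq hU x
    refine ⟨x₁, hx₁, (eq_and_eq_of_add_eq_add hV.disjoint (hE₁ _ hx₁) hz (hE₂ _ hx₂)
      (zero_mem _) ?_).1⟩
    rw [add_zero, ← map_add]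
    exact hx

/-- The resolvents of `A₁ E₁⁻¹` and `E₁⁻¹ A₁` are restrictions of the pseudo-resolvents of the
pencil, and so inherit their polynomial growth. -/
theorem generates_of_isRadial {U₁ U₂ : Submodule ℂ X} {V₁ V₂ : Submodule ℂ Z}
    [CompleteSpace U₁] [CompleteSpace V₁] (W : WeierstrassSplitting E A U₁ U₂ V₁ V₂)
    {ω C : ℝ} {p : ℕ} (hω : 0 < ω) (hC : 0 < C) (hρ : ∀ l : ℂ, ω < l.re → l ∈ resolventSet E A)
    (hP : IsPseudoResolvent.IsRadial (fun z => resolvent E A z ∘L E) ω C p)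
    (hQ : IsPseudoResolvent.IsRadial (fun z => E ∘L resolvent E A z) ω C p) :
    GeneratesIntegratedSemigroup W.A₁E₁inv ∧ GeneratesIntegratedSemigroup W.E₁invA₁ := by
  obtain ⟨K, hK⟩ := ((isPseudoResolvent_left E A).mono hρ).exists_norm_le_mul_pow hω hC hP
  obtain ⟨K', hK'⟩ := ((isPseudoResolvent_right E A).mono hρ).exists_norm_le_mul_pow hω hC hQ
  have hres : ∀ z : ℂ, ω + 1 ≤ z.re → IsPencilInverse E A z (resolvent E A z) := fun z hz =>
    isPencilInverse_resolvent (hρ z (by linarith))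
  have ha : 1 ≤ ω + 1 := by linarith
  refine ⟨generatesIntegratedSemigroup_of_exists (K := K') (p := p) ha fun z hz => ?_,
    generatesIntegratedSemigroup_of_exists (K := K) (p := p) ha fun z hz => ?_⟩
  · obtain ⟨B', hB', hn⟩ := W.exists_resolvent_A₁E₁inv (hres z hz)
    exact ⟨B', hB', hn.trans (hK' z hz)⟩
  · obtain ⟨B', hB', hn⟩ := W.exists_resolvent_E₁invA₁ (hres z hz)
    exact ⟨B', hB', hn.trans (hK z hz)⟩

end Spectral

end DAE

open DAE IsPseudoResolvent in
theorem mainTheorem9 {X Z : Type*}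
    [NormedAddCommGroup X] [InnerProductSpace ℂ X] [CompleteSpace X]
    [NormedAddCommGroup Z] [InnerProductSpace ℂ Z] [CompleteSpace Z]
    (E : X →L[ℂ] Z) (A : X →ₗ.[ℂ] Z)
    (hE : IsClosed (Set.range E))
    (hA_closed : A.IsClosed) (hA_dense : Dense (A.domain : Set X))
    (p : ℕ) (hp : DAE.HasComplexRadialityIndex E A p)
    (lam : Fin (p + 1) → ℂ) (hlam : ∀ k, lam k ∈ DAE.resolventSet E A) :
    ∃ W : DAE.WeierstrassSplitting E A (DAE.X₁ E A lam) (DAE.X₂ E A lam)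
        (DAE.Z₁ E A lam) (DAE.Z₂ E A lam),
      DAE.GeneratesIntegratedSemigroup W.A₁E₁inv ∧
      DAE.GeneratesIntegratedSemigroup W.E₁invA₁ := by
  obtain ⟨ω, C, hω, hC, hρ, hbound⟩ := hp
  have hPr : IsRadial (fun z => DAE.resolvent E A z ∘L E) ω C p := isRadial_of_ofFn fun lam' h => by
    rw [← leftProd_eq]
    exact (hbound lam' h).1
  have hQr : IsRadial (fun z => E ∘L DAE.resolvent E A z) ω C p := isRadial_of_ofFn fun lam' h => by
    rw [← rightProd_eq]
    exact (hbound lam' h).2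
  have hPps := isPseudoResolvent_left E A
  have hQps := isPseudoResolvent_right E A
  have hmρ : ((ω + 1 : ℝ) : ℂ) ∈ DAE.resolventSet E A := hρ _ (by simp)
  have hls : ∀ l ∈ List.ofFn lam, l ∈ DAE.resolventSet E A := by
    intro l hl
    obtain ⟨k, rfl⟩ := List.mem_ofFn.1 hl
    exact hlam k
  -- The four subspaces do not depend on `lam`, so every `lam k` may be replaced by `ω + 1`.
  obtain ⟨hPk, hPran⟩ := hPps.ker_range_prod hmρ (List.ofFn lam) hls
  obtain ⟨hQk, hQran⟩ := hQps.ker_range_prod hmρ (List.ofFn lam) hls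
  rw [← leftProd_eq, List.length_ofFn] at hPk hPran
  rw [← rightProd_eq, List.length_ofFn] at hQk hQran
  obtain ⟨S, hSc, hSM, hST⟩ := (hPps.mono hρ).exists_approximate_identity hC hPr
  obtain ⟨S', hSc', hSM', hST'⟩ := (hQps.mono hρ).exists_approximate_identity hC hQr
  have hW := nonempty_weierstrassSplitting_of_isCompl hE (isPencilInverse_resolvent hmρ) p rfl rfl
    (isCompl_closure_range_ker hSc hSM hST) (isCompl_closure_range_ker hSc' hSM' hST')
  rw [← hPk, ← hPran, ← hQk, ← hQran] at hW
  exact hW.elim fun W => ⟨W, generates_of_isRadial W hω hC hρ hPr hQr⟩
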